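/- Let $b:[-1/2,1/2]\to(0,\infty)$ be even, continuous, concave, and (not necessarily strictly) decreasing on $[0,1/2]$; thus $b'$ exists and is continuous off a countable set. Let $\alpha_M=\sup|\arctan b'|$ (over the points of $(-1/2,1/2)$ where $b'$ exists) and let $\alpha_M<\theta<\pi/2$. Let $Q=\{(X,Y): 0\le Y\le 1/2,\ 0\le X\le b(Y)\}$ be the table, whose right boundary is the curve $X=b(Y)$. The internal-wave billiard in $Q$ (in which the direction of motion always forms the angle $\theta$ with the vertical direction, up to sign and supplement; all reflections at the right boundary are then vertical) unfolds to the linear flow on the fourfold copy $\tilde Q=\{(x,y): |x|\le 1/2,\ |y|\le b(x)\}$ of $Q$: motion with constant velocity $(\cos\theta,\sin\theta)$, where a trajectory hitting a boundary point continues, with the same velocity, from the opposite one, the points $(-1/2,y)$ and $(1/2,y)$ being opposite to each other, and likewise $(x,b(x))$ and $(x,-b(x))$. Identify the segment $\Sigma=\{y=0\}\subset\tilde Q$ with $\mathbb T=\mathbb R/\mathbb Z$. Then the first-return map of this flow to $\Sigma$ is a well-defined homeomorphism $f:\mathbb T\to\mathbb T$. It has lifts, that is, homeomorphisms $F$ of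 $\mathbb R$ with $F(x+k)=F(x)+k$ for $k\in\mathbb Z$ that induce $f$, and it has a rotation number $\rho\in[0,1)$: for each lift $F$, $\lim_n (F^n(x)-x)/n$ exists, does not depend on $x$, and equals $\rho$ mod $1$. Moreover: (i) If $\rho\notin\mathbb Q$, there is a homeomorphism $h$ of $\mathbb T$ with $h(f(x))=h(x)+\rho$ for all $x$; in particular every forward orbit of $f$ is dense. (ii) Let $\rho=p/q$ with $p\ge 0$, $q\ge 1$ coprime integers (so $q=1$ if $p=0$), and let indices $i$ be taken mod $q$. There are closed arcs (possibly single points or the whole circle) $\mathcal P_i^\pm\subset\mathbb T$, $i\in\mathbb Z/q$, with union $\mathcal P^\pm=\bigcup_i\mathcal P_i^\pm$, such that all points of $\mathcal P^+\cup\mathcal P^-$ are periodic with minimal period $q$, all other points are non-periodic, and $f^n(\mathcal P_i^\pm)=\mathcal P_{i+pn}^\pm$ for all $i$ and $n\in\mathbb N$. Moreover one of the following holds. (Cyclic orderings and arcs are understood through real representatives $u_i$, $i\in\mathbb Z$, with $u_{i+q}=u_i+1$.) (a) $\mathcal P_i^\pm=\{x_i^\pm\}$ are points with $x_0^-\le x_0^+\le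 x_1^-\le x_1^+\le\dots\le x_{q-1}^-\le x_{q-1}^+\le x_0^-$ in the cyclic order, and $f^n(x_i^\pm)=x_{i+pn}^\pm$ for all $i$ and $n\in\mathbb N$. For $x\in(x_i^-,x_i^+)$ and $n\in\mathbb N$ one has $f^n(x)\in(x_{i+pn}^-,x_{i+pn}^+)$, and $f^{nq}(x)\to x_i^+$ as $n\to+\infty$, $f^{nq}(x)\to x_i^-$ as $n\to-\infty$. For $x\in(x_i^+,x_{i+1}^-)$ and $n\in\mathbb N$ one has $f^n(x)\in(x_{i+pn}^+,x_{i+1+pn}^-)$, and $f^{nq}(x)\to x_i^+$ as $n\to+\infty$, $f^{nq}(x)\to x_{i+1}^-$ as $n\to-\infty$. Hence the (possibly coinciding) periodic orbits $\mathcal O^\pm=\{x_0^\pm,\dots,x_{q-1}^\pm\}$ are the global attractor and repellor: the set of limit points of the forward orbit of every $x\notin\mathcal O^-$ is $\mathcal O^+$, and that of the backward orbit of every $x\notin\mathcal O^+$ is $\mathcal O^-$. (b) $\mathcal P_i^+=\mathcal P_i^-=[x_i^L,x_i^R]$ are non-degenerate, with $x_0^L<x_0^R\le x_1^L<x_1^R\le\dots\le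 x_{q-1}^L<x_{q-1}^R\le x_0^L$ in the cyclic order, and $x_i^R<x_{i+1}^L$ holds for some $i$ if and only if it holds for all $i$. (1) If $x_i^R<x_{i+1}^L$ for all $i$, then for all $i$, $x\in(x_i^R,x_{i+1}^L)$ and $n\in\mathbb N$ one has $f^n(x)\in(x_{i+pn}^R,x_{i+1+pn}^L)$, and $f^{nq}(x)\to x_i^R$ as $n\to+\infty$, $f^{nq}(x)\to x_{i+1}^L$ as $n\to-\infty$. Hence, for every $x\notin\mathcal P^+$, the set of limit points of the forward orbit is $\mathcal O^+=\{x_0^R,\dots,x_{q-1}^R\}$ and that of the backward orbit is $\mathcal O^-=\{x_0^L,\dots,x_{q-1}^L\}$. (2) If $x_i^R=x_{i+1}^L$ for all $i$, then all orbits are periodic. If $b$ is strictly concave on $[-1/2,1/2]$ (equivalently, the right boundary of the table contains no segment), then case (b) cannot occur. -/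

import Mathlib

open Set Filter Topology

namespace InternalWave

noncomputable section

/-! ### The unfolded table -/

/-- The profile `b` of an admissible table.  The table is
`{(X, Y) | 0 ≤ Y ≤ 1/2, 0 ≤ X ≤ b Y}`; its right boundary is the curve `X = b Y`, extended to
`Y ∈ [-1/2, 1/2]` as an even function.  (A concave function is differentiable, with continuous
derivative, outside a countable set of points, so no further regularity is required.) -/
structure IsProfile (b : ℝ → ℝ) : Prop where
  pos : ∀ x ∈ Icc (-1 / 2 : ℝ) (1 / 2), 0 < b x
  even : ∀ x ∈ Icc (-1 / 2 : ℝ) (1 / 2), b (-x) = b x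
  continuousOn : ContinuousOn b (Icc (-1 / 2) (1 / 2))
  concaveOn : ConcaveOn ℝ (Icc (-1 / 2) (1 / 2)) b
  antitoneOn : AntitoneOn b (Icc 0 (1 / 2))

/-- The maximal angle `α_M` that the right boundary of the table makes with the vertical: the
supremum of `|α(x)|`, where `α(x) = arctan (b' x)` wherever `b` is differentiable. -/
def alphaMax (b : ℝ → ℝ) : ℝ :=
  sSup {a : ℝ | ∃ x ∈ Ioo (-1 / 2 : ℝ) (1 / 2), DifferentiableAt ℝ b x ∧
    a = |Real.arctan (deriv b x)|}

/-- The upper boundary of the unfolded table, as a function on the circle `ℝ/ℤ`, which arises from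
`[-1/2, 1/2]` by identifying the left and the right boundary. -/
def roof (b : ℝ → ℝ) : UnitAddCircle → ℝ :=
  AddCircle.liftIco (1 : ℝ) (-1 / 2) b

/-- The unfolded table `{(x, y) | -b x ≤ y ≤ b x}` after identification of opposite boundary
points.  Left and right boundary are identified by taking `x ∈ ℝ/ℤ`.  The upper boundary point
`(x, b x)` is identified with the lower one `(x, -b x)`, so every point of the surface has exactly
one representative with `-b x ≤ y < b x`. -/
def surface (b : ℝ → ℝ) : Set (UnitAddCircle × ℝ) :=
  {P | -roof b P.1 ≤ P.2 ∧ P.2 < roof b P.1}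

/-! ### The linear flow and its first-return map -/

/-- Straight motion with unit speed in direction `θ` during time `s`. -/
def move (θ s : ℝ) (P : UnitAddCircle × ℝ) : UnitAddCircle × ℝ :=
  (P.1 + ((s * Real.cos θ : ℝ) : UnitAddCircle), P.2 + s * Real.sin θ)

/-- `γ`, restricted to `[0, T]`, is a trajectory of the linear flow of direction `θ`.  From each of
its points it leaves straight in direction `θ`; and it arrives straight in direction `θ` at each of
its points, except that, when it arrives at an upper boundary point `(x, b x)`, it is at that time
at the opposite point `(x, -b x)` and continues from there. -/
structure IsTrajectory (b : ℝ → ℝ) (θ T : ℝ) (γ : ℝ → UnitAddCircle × ℝ) : Prop where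
  mem : ∀ t ∈ Icc 0 T, γ t ∈ surface b
  leaves : ∀ t ∈ Ico 0 T, ∃ ε > 0, ∀ s ∈ Ioc 0 ε, t + s ≤ T → γ (t + s) = move θ s (γ t)
  arrives : ∀ t ∈ Ioc 0 T, ∃ ε > 0,
    (∀ s ∈ Ioc 0 ε, s ≤ t → γ (t - s) = move θ (-s) (γ t)) ∨
    ((γ t).2 = -roof b (γ t).1 ∧
      ∀ s ∈ Ioc 0 ε, s ≤ t → γ (t - s) = move θ (-s) ((γ t).1, roof b (γ t).1))

/-- The trajectory that starts at the point `x` of the horizontal section `Σ = {y = 0}` returns to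
`Σ` for the first time at the point `x'`. -/
def FirstReturn (b : ℝ → ℝ) (θ : ℝ) (x x' : UnitAddCircle) : Prop :=
  ∃ T > 0, ∃ γ : ℝ → UnitAddCircle × ℝ, IsTrajectory b θ T γ ∧
    γ 0 = (x, 0) ∧ γ T = (x', 0) ∧ ∀ t ∈ Ioo 0 T, (γ t).2 ≠ 0

/-! ### Circle homeomorphisms -/

/-- `F` is a lift of the circle homeomorphism `f`. -/
def IsLift (f : UnitAddCircle ≃ₜ UnitAddCircle) (F : ℝ ≃ₜ ℝ) : Prop :=
  (∀ (x : ℝ) (k : ℤ), F (x + k) = F x + k) ∧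
    ∀ x : ℝ, ((F x : ℝ) : UnitAddCircle) = f (x : UnitAddCircle)

/-- `f` has lifts, and `ρ ∈ [0, 1)` is its rotation number: for every lift `F`, the limit of
`(F^n x - x) / n` is the same for all `x` and equals `ρ` modulo `1`. -/
def HasRotationNumber (f : UnitAddCircle ≃ₜ UnitAddCircle) (ρ : ℝ) : Prop :=
  ρ ∈ Ico (0 : ℝ) 1 ∧ (∃ F : ℝ ≃ₜ ℝ, IsLift f F) ∧
    ∀ F : ℝ ≃ₜ ℝ, IsLift f F → ∃ m : ℤ, ∀ x : ℝ,
      Tendsto (fun n : ℕ => (F^[n] x - x) / n) atTop (𝓝 (ρ + m))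

/-- The image in the circle of `[u, v]`. -/
def closedArc (u v : ℝ) : Set UnitAddCircle :=
  (fun t : ℝ => (t : UnitAddCircle)) '' Icc u v

/-- The image in the circle of `(u, v)`. -/
def openArc (u v : ℝ) : Set UnitAddCircle :=
  (fun t : ℝ => (t : UnitAddCircle)) '' Ioo u v

/-- The set of limit points of the forward orbit of `x`. -/
def forwardLimit (f : UnitAddCircle ≃ₜ UnitAddCircle) (x : UnitAddCircle) : Set UnitAddCircle :=
  omegaLimit atTop (fun (n : ℕ) (y : UnitAddCircle) => f^[n] y) {x}

/-- The set of limit points of the backward orbit of `x`. -/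
def backwardLimit (f : UnitAddCircle ≃ₜ UnitAddCircle) (x : UnitAddCircle) : Set UnitAddCircle :=
  forwardLimit f.symm x

/-- A cyclically indexed family of points of the circle, given by real representatives: `u i`
represents the point with index `i mod q`, and going once around the circle adds `1`.  Cyclic
orderings of such points become orderings of the representatives. -/
def IsCyclic (q : ℕ) (u : ℤ → ℝ) : Prop :=
  ∀ i : ℤ, u (i + q) = u i + 1

/-- The point of the circle represented by a real number. -/
abbrev pt (t : ℝ) : UnitAddCircle := (t : UnitAddCircle)

/-- The sets `𝒫^± = ⋃ i, 𝒫_i^±`: unions of closed intervals, consisting of `q`-periodic points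
(with minimal period `q`), such that `f^n` maps `𝒫_i^±` onto `𝒫_{i+pn}^±`, and outside of which
there are no periodic points. -/
structure IsPeriodicDecomposition (f : UnitAddCircle ≃ₜ UnitAddCircle) (p q : ℕ)
    (Pminus Pplus : ZMod q → Set UnitAddCircle) : Prop where
  arc_minus : ∀ i, ∃ u v : ℝ, u ≤ v ∧ v ≤ u + 1 ∧ Pminus i = closedArc u v
  arc_plus : ∀ i, ∃ u v : ℝ, u ≤ v ∧ v ≤ u + 1 ∧ Pplus i = closedArc u v
  period : ∀ x ∈ (⋃ i, Pplus i) ∪ ⋃ i, Pminus i, Function.minimalPeriod f x = q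
  image_minus : ∀ (i : ZMod q) (n : ℕ), f^[n] '' Pminus i = Pminus (i + p * n)
  image_plus : ∀ (i : ZMod q) (n : ℕ), f^[n] '' Pplus i = Pplus (i + p * n)
  aperiodic : ∀ x ∉ (⋃ i, Pplus i) ∪ ⋃ i, Pminus i, x ∉ Function.periodicPts f

/-- For every point of the open arc from `u i` to `v i`, for all `i`: its `n`-th image lies in the
open arc with index `i + pn`, its images under `f^{nq}` tend to `w i`, and its preimages under
`f^{nq}` tend to `z i`. -/
def ArcDynamics (f : UnitAddCircle ≃ₜ UnitAddCircle) (p q : ℕ) (u v w z : ℤ → ℝ) : Prop :=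
  ∀ i : ℤ, ∀ x ∈ openArc (u i) (v i),
    (∀ n : ℕ, f^[n] x ∈ openArc (u (i + p * n)) (v (i + p * n))) ∧
    Tendsto (fun n : ℕ => f^[n * q] x) atTop (𝓝 (pt (w i))) ∧
    Tendsto (fun n : ℕ => f.symm^[n * q] x) atTop (𝓝 (pt (z i)))

/-- Case (a): all the intervals are points `x_i^±`. -/
def CaseA (f : UnitAddCircle ≃ₜ UnitAddCircle) (p q : ℕ)
    (Pminus Pplus : ZMod q → Set UnitAddCircle) : Prop :=
  ∃ xm xp : ℤ → ℝ, IsCyclic q xm ∧ IsCyclic q xp ∧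
    (∀ i : ℤ, Pminus i = {pt (xm i)} ∧ Pplus i = {pt (xp i)}) ∧
    (∀ i, xm i ≤ xp i ∧ xp i ≤ xm (i + 1)) ∧
    (∀ (i : ℤ) (n : ℕ), f^[n] (pt (xm i)) = pt (xm (i + p * n)) ∧
      f^[n] (pt (xp i)) = pt (xp (i + p * n))) ∧
    ArcDynamics f p q xm xp xp xm ∧
    ArcDynamics f p q xp (fun i => xm (i + 1)) xp (fun i => xm (i + 1)) ∧
    (∀ x ∉ range (fun i => pt (xm i)), forwardLimit f x = range (fun i => pt (xp i))) ∧
    (∀ x ∉ range (fun i => pt (xp i)), backwardLimit f x = range (fun i => pt (xm i)))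

/-- Case (b): all the intervals `[x_i^L, x_i^R]` are non-degenerate. -/
def CaseB (f : UnitAddCircle ≃ₜ UnitAddCircle) (p q : ℕ)
    (Pminus Pplus : ZMod q → Set UnitAddCircle) : Prop :=
  ∃ xL xR : ℤ → ℝ, IsCyclic q xL ∧ IsCyclic q xR ∧
    (∀ i : ℤ, Pplus i = closedArc (xL i) (xR i) ∧ Pminus i = closedArc (xL i) (xR i)) ∧
    (∀ i, xL i < xR i ∧ xR i ≤ xL (i + 1)) ∧
    ((∃ i, xR i < xL (i + 1)) ↔ ∀ i, xR i < xL (i + 1)) ∧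
    ((∀ i, xR i < xL (i + 1)) →
      ArcDynamics f p q xR (fun i => xL (i + 1)) xR (fun i => xL (i + 1)) ∧
      ∀ x ∉ ⋃ i, Pplus i,
        forwardLimit f x = range (fun i => pt (xR i)) ∧
        backwardLimit f x = range (fun i => pt (xL i))) ∧
    ((∀ i, xR i = xL (i + 1)) → ∀ x, x ∈ Function.periodicPts f)

end

end InternalWave

open InternalWave

namespace InternalWave

/-! ### The slope of the roof -/

/-! A trajectory that meets the roof above `w` leaves `Σ` at `w - β w` and returns at `w + β w`,
where `β = roof / tan θ`. So the return map has the lift `g = (id + β) ∘ (id - β)⁻¹`. Since `θ`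
exceeds the maximal angle, `β` is Lipschitz with a constant below `1`, and `g` is a bi-Lipschitz
homeomorphism. Since the profile is concave, `id - β` is convex on a period, its inverse is concave,
and so is `g = 2 (id - β)⁻¹ - id`. Thus `g` is concave on an interval `[c, c + 1]`, with its only
break at `c` modulo `1` (`exists_concave_lift`, `firstReturn_pt`). Everything else follows from this
one-sided concavity; no further smoothness is needed.

Irrational rotation number: Poincaré's semiconjugacy `H` to the rotation could fail to be injective
only on a wandering interval `I`. Take `p / q` slightly above `ρ`. Then `g^(j-q) I + p` lies just to
the right of `g^j I`, so by concavity `g` stretches it by at most the same factor, unless a break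
point lies in between. In rotation coordinates this happens for at most two `j < q`
(`card_le_two_of_approx`). Multiplying over `j` bounds `|I|²` by a constant times `|g^q I| |g^(-q)
I|` (`sq_length_le`), whereas the lengths of the disjoint translates tend to `0` in both directions.
Hence `H` is a conjugacy (`exists_conj_rotation`).

Rational rotation number `p / q`: periodic points lift to fixed points of `Φ = g^q - p`. Bézout
coefficients give a map `S`, commuting with `g`, of translation number `1 / q`, which acts on these
points as a `q`-th root of the full turn (`exists_isSuccessor`). If `z` is fixed and `z ≤ c < S z`,
no intermediate image of `[c, S z]` has a break point in its interior, so `Φ - id` is concave on it.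
A concave function vanishing at two points is positive between them or vanishes identically there.
Hence, modulo `S`, there is one repelling and one attracting point, possibly equal, or one interval
of fixed points (`exists_fixed_pattern`). These are the cases (a) and (b), and strict concavity
rules out the interval. -/

lemma IsProfile.exists_differentiableAt {b : ℝ → ℝ} (hb : IsProfile b) {x y : ℝ}
    (hx : -1 / 2 ≤ x) (hxy : x < y) (hy : y ≤ 1 / 2) :
    ∃ z ∈ Ioo x y, DifferentiableAt ℝ b z := by
  have key : ∀ x y : ℝ, 0 ≤ x → x < y → y ≤ 1 / 2 → ∃ z ∈ Ioo x y, DifferentiableAt ℝ b z := by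
    intro x y hx hxy hy
    have hm : MonotoneOn (fun t => -b t) (Icc 0 (1 / 2)) := fun s hs t ht hst =>
      neg_le_neg (hb.antitoneOn hs ht hst)
    -- Lebesgue's theorem: a monotone function is differentiable almost everywhere, so the
    -- exceptional set contains no open interval.
    have hae := hm.ae_differentiableWithinAt_of_mem
    by_contra! hcon
    have hsub : Ioo x y ⊆ {t | ¬(t ∈ Icc (0 : ℝ) (1 / 2) →
        DifferentiableWithinAt ℝ (fun t => -b t) (Icc 0 (1 / 2)) t)} := by
      intro t ht hd
      have ht' : t ∈ Icc (0 : ℝ) (1 / 2) := ⟨hx.trans ht.1.le, ht.2.le.trans hy⟩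
      have hnhds : Icc (0 : ℝ) (1 / 2) ∈ 𝓝 t :=
        Icc_mem_nhds (hx.trans_lt ht.1) (ht.2.trans_le hy)
      have := ((hd ht').differentiableAt hnhds).neg
      simp only [Pi.neg_def, neg_neg] at this
      exact hcon t ht this
    have h0 := MeasureTheory.measure_mono_null hsub (MeasureTheory.ae_iff.1 hae)
    rw [Real.volume_Ioo, ENNReal.ofReal_eq_zero] at h0
    linarith
  -- Monotonicity is known only on the right half; an interval in the left half is reflected by
  -- evenness, and any other one meets the right half.
  rcases le_or_gt y 0 with hy0 | hy0
  · obtain ⟨z, hz, hd⟩ := key (-y) (-x) (by linarith) (by linarith) (by linarith)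
    refine ⟨-z, ⟨by linarith [hz.2], by linarith [hz.1]⟩, ?_⟩
    have h1 : DifferentiableAt ℝ (fun t => b (-t)) (-z) := by
      have hd' : DifferentiableAt ℝ b (- -z) := by rwa [neg_neg]
      exact DifferentiableAt.comp (g := b) (-z) hd' differentiableAt_fun_id.neg
    refine h1.congr_of_eventuallyEq ?_
    have : Icc (-1 / 2 : ℝ) (1 / 2) ∈ 𝓝 (-z) :=
      Icc_mem_nhds (by linarith [hz.2]) (by linarith [hz.1])
    filter_upwards [this] with t ht
    exact (hb.even t ht).symm
  · obtain ⟨z, hz, hd⟩ := key (max x 0) y (le_max_right _ _) (max_lt hxy hy0) hy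
    exact ⟨z, ⟨(le_max_left _ _).trans_lt hz.1, hz.2⟩, hd⟩

lemma alphaMax_nonneg (b : ℝ → ℝ) : 0 ≤ alphaMax b :=
  Real.sSup_nonneg (by rintro _ ⟨x, -, -, rfl⟩; exact abs_nonneg _)

lemma abs_deriv_le_tan_alphaMax {b : ℝ → ℝ} (hα : alphaMax b < Real.pi / 2) {z : ℝ}
    (hz : z ∈ Ioo (-1 / 2 : ℝ) (1 / 2)) (hd : DifferentiableAt ℝ b z) :
    |deriv b z| ≤ Real.tan (alphaMax b) := by
  have h0 := alphaMax_nonneg b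
  have hle : |Real.arctan (deriv b z)| ≤ alphaMax b := by
    -- Boundedness matters: the real `sSup` of a set that is not bounded above is `0`.
    refine le_csSup ⟨Real.pi / 2, ?_⟩ ⟨z, hz, hd, rfl⟩
    rintro _ ⟨x, -, -, rfl⟩
    exact abs_le.2 ⟨(Real.neg_pi_div_two_lt_arctan _).le, (Real.arctan_lt_pi_div_two _).le⟩
  obtain ⟨h1, h2⟩ := abs_le.1 hle
  have hmono := Real.strictMonoOn_tan.monotoneOn
  have hmem := Real.arctan_mem_Ioo (deriv b z)
  have hmemα : alphaMax b ∈ Ioo (-(Real.pi / 2)) (Real.pi / 2) := ⟨by linarith [Real.pi_pos], hα⟩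
  have hmemα' : -alphaMax b ∈ Ioo (-(Real.pi / 2)) (Real.pi / 2) := ⟨by linarith, by linarith⟩
  rw [abs_le]
  constructor
  · have := hmono hmemα' hmem h1
    rwa [Real.tan_arctan, Real.tan_neg] at this
  · have := hmono hmem hmemα h2
    rwa [Real.tan_arctan] at this

/-- The derivative is controlled only where it exists. By concavity the slope of any chord lies
between the derivatives at differentiability points to its right and to its left, so these points
suffice in the interior; continuity extends the Lipschitz bound to the endpoints. -/
lemma IsProfile.abs_sub_le {b : ℝ → ℝ} (hb : IsProfile b) (hα : alphaMax b < Real.pi / 2)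
    {x y : ℝ} (hx : -1 / 2 ≤ x) (hxy : x ≤ y) (hy : y ≤ 1 / 2) :
    |b y - b x| ≤ Real.tan (alphaMax b) * (y - x) := by
  have hint : ∀ x ∈ Ioo (-1 / 2 : ℝ) (1 / 2), ∀ y ∈ Ioo (-1 / 2 : ℝ) (1 / 2), x < y →
      |b y - b x| ≤ Real.tan (alphaMax b) * (y - x) := by
    intro x hx y hy hxy
    obtain ⟨z, hz, hdz⟩ := hb.exists_differentiableAt le_rfl hx.1 hx.2.le
    obtain ⟨w, hw, hdw⟩ := hb.exists_differentiableAt hy.1.le hy.2 le_rfl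
    have hxI := Ioo_subset_Icc_self hx
    have hyI := Ioo_subset_Icc_self hy
    have hzI : z ∈ Ioo (-1 / 2 : ℝ) (1 / 2) := ⟨hz.1, hz.2.trans hx.2⟩
    have hwI : w ∈ Ioo (-1 / 2 : ℝ) (1 / 2) := ⟨hy.1.trans hw.1, hw.2⟩
    have hbz := (abs_le.1 (abs_deriv_le_tan_alphaMax hα hzI hdz)).2
    have hbw := (abs_le.1 (abs_deriv_le_tan_alphaMax hα hwI hdw)).1
    have hs1 : slope b z x ≤ deriv b z :=
      hb.concaveOn.slope_le_deriv (Ioo_subset_Icc_self hzI) hxI hz.2 hdz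
    have hs2 : deriv b w ≤ slope b y w :=
      hb.concaveOn.deriv_le_slope hyI (Ioo_subset_Icc_self hwI) hw.1 hdw
    have hs3 := hb.concaveOn.slope_anti_adjacent (Ioo_subset_Icc_self hzI) hyI hz.2 hxy
    have hs4 := hb.concaveOn.slope_anti_adjacent hxI (Ioo_subset_Icc_self hwI) hxy hw.1
    rw [slope_def_field] at hs1 hs2
    have hpos : 0 < y - x := sub_pos.2 hxy
    rw [abs_le]
    constructor
    · have : -Real.tan (alphaMax b) ≤ (b y - b x) / (y - x) := by linarith
      rw [le_div_iff₀ hpos] at this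
      linarith
    · have : (b y - b x) / (y - x) ≤ Real.tan (alphaMax b) := by linarith
      rwa [div_le_iff₀ hpos] at this
  have hL : LipschitzOnWith (Real.tan (alphaMax b)).toNNReal b (Ioo (-1 / 2 : ℝ) (1 / 2)) := by
    have h0 : 0 ≤ Real.tan (alphaMax b) :=
      Real.tan_nonneg_of_nonneg_of_le_pi_div_two (alphaMax_nonneg b) hα.le
    refine LipschitzOnWith.of_dist_le_mul fun s hs t ht => ?_
    rw [Real.coe_toNNReal _ h0, Real.dist_eq, Real.dist_eq]
    rcases lt_trichotomy s t with h | h | h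
    · rw [abs_sub_comm, abs_sub_comm s, abs_of_pos (sub_pos.2 h)]
      exact hint s hs t ht h
    · simp [h]
    · rw [abs_of_pos (sub_pos.2 h)]
      exact hint t ht s hs h
  have hcl : closure (Ioo (-1 / 2 : ℝ) (1 / 2)) = Icc (-1 / 2) (1 / 2) :=
    closure_Ioo (by norm_num)
  have hL' := hL.closure (by rw [hcl]; exact hb.continuousOn)
  rw [hcl] at hL'
  have := hL'.dist_le_mul y ⟨hx.trans hxy, hy⟩ x ⟨hx, hxy.trans hy⟩
  rwa [Real.coe_toNNReal _ (Real.tan_nonneg_of_nonneg_of_le_pi_div_two (alphaMax_nonneg b) hα.le),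
    Real.dist_eq, Real.dist_eq, abs_of_nonneg (sub_nonneg.2 hxy)] at this

/-! ### The periodic roof -/

lemma roof_coe_of_mem {b : ℝ → ℝ} (hb : IsProfile b) {t : ℝ} (ht : t ∈ Icc (-1 / 2 : ℝ) (1 / 2)) :
    roof b (t : UnitAddCircle) = b t := by
  have : Fact ((0 : ℝ) < 1) := ⟨one_pos⟩
  rcases ht.2.lt_or_eq with h | h
  · exact AddCircle.liftIco_coe_apply ⟨ht.1, by linarith⟩
  · have h1 : (t : UnitAddCircle) = ((-1 / 2 : ℝ) : UnitAddCircle) := by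
      rw [h, ← AddCircle.coe_add_period 1 (-1 / 2 : ℝ)]
      norm_num
    have h2 : roof b ((-1 / 2 : ℝ) : UnitAddCircle) = b (-1 / 2) :=
      AddCircle.liftIco_coe_apply ⟨le_rfl, by norm_num⟩
    rw [h1, h2, h, ← hb.even (1 / 2) ⟨by norm_num, le_rfl⟩]
    norm_num

lemma pt_add_one (t : ℝ) : pt (t + 1) = pt t := AddCircle.coe_add_period 1 t

lemma pt_add_int (t : ℝ) (m : ℤ) : pt (t + m) = pt t := by
  rw [pt, AddCircle.coe_add]
  simp

lemma pt_eq_pt_iff {s t : ℝ} : pt s = pt t ↔ ∃ m : ℤ, t = s + m := by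
  constructor
  · intro h
    obtain ⟨m, hm⟩ := (QuotientAddGroup.eq_iff_sub_mem.1 h.symm)
    refine ⟨m, ?_⟩
    simp only [zsmul_eq_mul, mul_one] at hm
    linarith
  · rintro ⟨m, rfl⟩
    exact (pt_add_int s m).symm

lemma exists_int_add_mem_Ico (x : ℝ) : ∃ m : ℤ, x + m ∈ Ico (-1 / 2 : ℝ) (1 / 2) := by
  refine ⟨-⌊x + 1 / 2⌋, ?_⟩
  push_cast
  constructor
  · linarith [Int.floor_le (x + 1 / 2)]
  · linarith [Int.lt_floor_add_one (x + 1 / 2)]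

lemma roof_pos {b : ℝ → ℝ} (hb : IsProfile b) (t : ℝ) : 0 < roof b (pt t) := by
  obtain ⟨m, hm⟩ := exists_int_add_mem_Ico t
  rw [← pt_add_int t m, pt, roof_coe_of_mem hb (Ico_subset_Icc_self hm)]
  exact hb.pos _ (Ico_subset_Icc_self hm)

lemma abs_roof_sub_le {b : ℝ → ℝ} (hb : IsProfile b) (hα : alphaMax b < Real.pi / 2)
    {x y : ℝ} (hxy : x ≤ y) :
    |roof b (pt y) - roof b (pt x)| ≤ Real.tan (alphaMax b) * (y - x) := by
  obtain ⟨m, hm⟩ := exists_int_add_mem_Ico x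
  obtain ⟨n, hn⟩ := exists_int_add_mem_Ico y
  have h0 : 0 ≤ Real.tan (alphaMax b) :=
    Real.tan_nonneg_of_nonneg_of_le_pi_div_two (alphaMax_nonneg b) hα.le
  have hx := roof_coe_of_mem hb (Ico_subset_Icc_self hm)
  have hy := roof_coe_of_mem hb (Ico_subset_Icc_self hn)
  rw [← pt_add_int x m, ← pt_add_int y n, pt, pt, hx, hy]
  rcases le_or_gt m n with hmn | hmn
  · rcases le_or_gt n m with hnm | hnm
    · obtain rfl : m = n := le_antisymm hmn hnm
      have := hb.abs_sub_le hα hm.1 (by linarith : x + m ≤ y + m) hn.2.le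
      rwa [add_sub_add_right_eq_sub] at this
    · exfalso
      have : (m : ℝ) + 1 ≤ n := by exact_mod_cast hnm
      linarith [hm.1, hn.2]
  -- Here `[x, y]` crosses a half-integer; the path is cut there, using `b (1/2) = b (-1/2)`, and
  -- the two pieces have total length at most `y - x`.
  · have hmn' : (n : ℝ) + 1 ≤ m := by exact_mod_cast hmn
    have h1 := hb.abs_sub_le hα le_rfl hn.1 hn.2.le
    have h2 := hb.abs_sub_le hα hm.1 hm.2.le le_rfl
    have h3 : b (1 / 2) = b (-1 / 2) := by
      rw [← hb.even (1 / 2) ⟨by norm_num, le_rfl⟩]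
      norm_num
    calc |b (y + n) - b (x + m)| = |(b (y + n) - b (-1 / 2)) + (b (1 / 2) - b (x + m))| := by
          rw [h3]; ring_nf
      _ ≤ _ := abs_add_le _ _
      _ ≤ Real.tan (alphaMax b) * ((y + n) - (-1 / 2) + (1 / 2 - (x + m))) := by
          rw [mul_add]; exact add_le_add h1 h2
      _ ≤ _ := mul_le_mul_of_nonneg_left (by linarith) h0

/-! ### The lift of the return map -/

/-- If `g` takes `w - β w` to `w + β w`, where `β` is `1`-periodic, Lipschitz with a constant
less than `1` and concave on an interval of length `1`, then `g` is the lift of a circle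
homeomorphism which is bi-Lipschitz, and concave outside of one point. -/
lemma exists_concave_lift {β : ℝ → ℝ} {κ : ℝ} (hκ0 : 0 ≤ κ) (hκ1 : κ < 1)
    (hper : ∀ x, β (x + 1) = β x) (hlip : ∀ x y, x ≤ y → |β y - β x| ≤ κ * (y - x))
    (hconc : ConcaveOn ℝ (Icc (-1 / 2) (1 / 2)) β) :
    ∃ (g : CircleDeg1Liftˣ) (c K : ℝ), 0 < K ∧ (∀ x, ∃ w, x = w - β w ∧ g x = w + β w) ∧
      ConcaveOn ℝ (Icc c (c + 1)) g ∧
      (∀ x y, x ≤ y → y - x ≤ K * (g y - g x)) ∧ (∀ x y, x ≤ y → g y - g x ≤ K * (y - x)) ∧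
      (StrictConcaveOn ℝ (Icc (-1 / 2) (1 / 2)) β → StrictConcaveOn ℝ (Icc c (c + 1)) g) := by
  have hcont : Continuous β := by
    refine (LipschitzWith.of_dist_le_mul (K := κ.toNNReal) fun x y => ?_).continuous
    rw [Real.dist_eq, Real.dist_eq, Real.coe_toNNReal _ hκ0]
    rcases le_total x y with h | h
    · rw [abs_sub_comm, abs_sub_comm x, abs_of_nonneg (sub_nonneg.2 h)]
      exact hlip x y h
    · rw [abs_of_nonneg (sub_nonneg.2 h)]
      exact hlip y x h
  have hlt : ∀ x y, x < y → |β y - β x| < y - x := fun x y h =>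
    (hlip x y h.le).trans_lt (by nlinarith)
  let gm : CircleDeg1Lift :=
    { toFun := fun w => w - β w
      monotone' := (show StrictMono fun w => w - β w from fun x y h => by
        have := (abs_lt.1 (hlt x y h)).2
        show x - β x < y - β y
        linarith).monotone
      map_add_one' := fun x => by simp only [hper]; ring }
  let gp : CircleDeg1Lift :=
    { toFun := fun w => w + β w
      monotone' := (show StrictMono fun w => w + β w from fun x y h => by
        have := (abs_lt.1 (hlt x y h)).1
        show x + β x < y + β y
        linarith).monotone
      map_add_one' := fun x => by simp only [hper]; ring }
  have hgm : IsUnit gm := by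
    refine CircleDeg1Lift.isUnit_iff_bijective.2 ⟨?_, ?_⟩
    · refine StrictMono.injective fun x y h => ?_
      have := (abs_lt.1 (hlt x y h)).2
      show x - β x < y - β y
      linarith
    · exact gm.continuous_iff_surjective.1 (continuous_id.sub hcont)
  have hgp : IsUnit gp := by
    refine CircleDeg1Lift.isUnit_iff_bijective.2 ⟨?_, ?_⟩
    · refine StrictMono.injective fun x y h => ?_
      have := (abs_lt.1 (hlt x y h)).1
      show x + β x < y + β y
      linarith
    · exact gp.continuous_iff_surjective.1 (continuous_id.add hcont)
  obtain ⟨um, hum⟩ := hgm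
  obtain ⟨up, hup⟩ := hgp
  have hW : ∀ w, (um⁻¹ : CircleDeg1Liftˣ) (w - β w) = w := fun w => by
    have := CircleDeg1Lift.units_inv_apply_apply um w
    rwa [hum] at this
  have hW' : ∀ x, ∃ w, x = w - β w := fun x => by
    refine ⟨(um⁻¹ : CircleDeg1Liftˣ) x, ?_⟩
    have := CircleDeg1Lift.units_apply_inv_apply um x
    rw [hum] at this
    exact this.symm
  have hg : ∀ w, ((up * um⁻¹ : CircleDeg1Liftˣ) : CircleDeg1Lift) (w - β w) = w + β w := fun w => by
    rw [Units.val_mul, CircleDeg1Lift.mul_apply, hW, hup]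
    rfl
  have hle : ∀ v w, v - β v ≤ w - β w ↔ v ≤ w := by
    have : StrictMono fun w => w - β w := fun x y h => by
      have := (abs_lt.1 (hlt x y h)).2
      show x - β x < y - β y
      linarith
    exact fun v w => this.le_iff_le
  have hmem : ∀ w, w - β w ∈ Icc (-1 / 2 - β (-1 / 2)) (-1 / 2 - β (-1 / 2) + 1) ↔
      w ∈ Icc (-1 / 2 : ℝ) (1 / 2) := fun w => by
    have : -1 / 2 - β (-1 / 2) + 1 = 1 / 2 - β (1 / 2) := by
      have := hper (-1 / 2)
      norm_num at this ⊢
      linarith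
    rw [this, mem_Icc, mem_Icc, hle, hle]
  -- The break point is the image of `-1/2` under `id - β`. The chords of `id - β` and `id + β` have
  -- slopes between `1 - κ` and `1 + κ`, whence the bi-Lipschitz constant.
  refine ⟨up * um⁻¹, -1 / 2 - β (-1 / 2), (1 + κ) / (1 - κ), by
    apply div_pos <;> linarith, fun x => ?_, ⟨convex_Icc _ _, ?_⟩, ?_, ?_, ?_⟩
  · obtain ⟨w, rfl⟩ := hW' x
    exact ⟨w, rfl, hg w⟩
  · intro x hx y hy s t hs ht hst
    obtain ⟨v, rfl⟩ := hW' x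
    obtain ⟨w, rfl⟩ := hW' y
    obtain ⟨z, hz⟩ := hW' (s • (v - β v) + t • (w - β w))
    rw [hz, hg, hg, hg]
    have h1 := hconc.2 ((hmem v).1 hx) ((hmem w).1 hy) hs ht hst
    simp only [smul_eq_mul] at *
    -- Convexity of `id - β` makes its inverse concave. Since `g (w - β w) = 2 w - (w - β w)`,
    -- concavity of `g` is exactly this inequality.
    have h2 : s * v + t * w ≤ z := by
      rw [← hle, ← hz]
      linarith
    linarith
  · intro x y hxy
    obtain ⟨v, rfl⟩ := hW' x
    obtain ⟨w, rfl⟩ := hW' y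
    rw [hg, hg]
    rw [hle] at hxy
    have h1 := abs_le.1 (hlip v w hxy)
    rw [div_mul_eq_mul_div, le_div_iff₀ (by linarith)]
    nlinarith
  · intro x y hxy
    obtain ⟨v, rfl⟩ := hW' x
    obtain ⟨w, rfl⟩ := hW' y
    rw [hg, hg]
    rw [hle] at hxy
    have h1 := abs_le.1 (hlip v w hxy)
    rw [div_mul_eq_mul_div, le_div_iff₀ (by linarith)]
    nlinarith
  · intro hsc
    refine ⟨convex_Icc _ _, ?_⟩
    intro x hx y hy hne s t hs ht hst
    obtain ⟨v, rfl⟩ := hW' x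
    obtain ⟨w, rfl⟩ := hW' y
    obtain ⟨z, hz⟩ := hW' (s • (v - β v) + t • (w - β w))
    rw [hz, hg, hg, hg]
    have hne' : v ≠ w := by rintro rfl; exact hne rfl
    have h1 := hsc.2 ((hmem v).1 hx) ((hmem w).1 hy) hne' hs ht hst
    simp only [smul_eq_mul] at *
    have h2 : s * v + t * w ≤ z := by
      rw [← hle, ← hz]
      linarith
    have h3 : s * v + t * w < z := by
      refine lt_of_le_of_ne h2 fun h => ?_
      rw [h] at h1
      linarith
    linarith

/-! ### Trajectories -/

lemma move_injective (θ s : ℝ) : Function.Injective (move θ s) := by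
  intro P Q h
  simp only [move, Prod.mk.injEq, add_left_inj] at h
  exact Prod.ext h.1 h.2

lemma IsTrajectory.mono {b : ℝ → ℝ} {θ T T' : ℝ} {γ : ℝ → UnitAddCircle × ℝ}
    (h : IsTrajectory b θ T γ) (hT : T' ≤ T) : IsTrajectory b θ T' γ where
  mem t ht := h.mem t ⟨ht.1, ht.2.trans hT⟩
  leaves t ht := by
    obtain ⟨ε, hε, H⟩ := h.leaves t ⟨ht.1, ht.2.trans_le hT⟩
    exact ⟨ε, hε, fun s hs hst => H s hs (hst.trans hT)⟩
  arrives t ht := h.arrives t ⟨ht.1, ht.2.trans hT⟩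

/-- A point at which a trajectory arrives is determined by the past of the trajectory. -/
lemma IsTrajectory.eq_of_eq_before {b : ℝ → ℝ} {θ T : ℝ} {γ γ' : ℝ → UnitAddCircle × ℝ}
    (h : IsTrajectory b θ T γ) (h' : IsTrajectory b θ T γ') {t : ℝ} (ht : t ∈ Ioc 0 T)
    (heq : ∀ s ∈ Ico 0 t, γ s = γ' s) : γ t = γ' t := by
  have hmem := (h.mem t (Ioc_subset_Icc_self ht)).2
  have hmem' := (h'.mem t (Ioc_subset_Icc_self ht)).2
  obtain ⟨ε, hε, H⟩ := h.arrives t ht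
  obtain ⟨ε', hε', H'⟩ := h'.arrives t ht
  obtain ⟨s, hs0, hs⟩ : ∃ s, 0 < s ∧ s ≤ min (min ε ε') t :=
    ⟨_, lt_min (lt_min hε hε') ht.1, le_rfl⟩
  have hsε : s ∈ Ioc 0 ε := ⟨hs0, hs.trans ((min_le_left _ _).trans (min_le_left _ _))⟩
  have hsε' : s ∈ Ioc 0 ε' := ⟨hs0, hs.trans ((min_le_left _ _).trans (min_le_right _ _))⟩
  have hst : s ≤ t := hs.trans (min_le_right _ _)
  have hs' := heq (t - s) ⟨by linarith, by linarith⟩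
  -- Two arrivals of the same kind give the same point. In the mixed cases one trajectory would sit
  -- on the upper boundary itself, which the half-open representation excludes.
  rcases H with H | ⟨H0, H⟩ <;> rcases H' with H' | ⟨H0', H'⟩ <;>
    rw [H s hsε hst, H' s hsε' hst] at hs' <;> have hP := move_injective _ _ hs'
  · exact hP
  · rw [hP] at hmem
    exact absurd hmem (lt_irrefl _)
  · rw [← hP] at hmem'
    exact absurd hmem' (lt_irrefl _)
  · rw [Prod.mk.injEq] at hP
    exact Prod.ext hP.1 (by rw [H0, H0', hP.1])

/-- A trajectory is determined by its starting point. -/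
lemma IsTrajectory.eqOn {b : ℝ → ℝ} {θ T : ℝ} {γ γ' : ℝ → UnitAddCircle × ℝ}
    (h : IsTrajectory b θ T γ) (h' : IsTrajectory b θ T γ') (h0 : γ 0 = γ' 0) :
    ∀ t ∈ Icc 0 T, γ t = γ' t := by
  by_contra! hcon
  -- At the infimum of the times of disagreement the trajectories still agree, by the arrival rule;
  -- the departure rule then carries the agreement a little further, a contradiction.
  set A := {t | t ∈ Icc 0 T ∧ γ t ≠ γ' t} with hA
  have hne : A.Nonempty := hcon
  have hbdd : BddBelow A := ⟨0, fun t ht => ht.1.1⟩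
  have hm0 : 0 ≤ sInf A := le_csInf hne fun t ht => ht.1.1
  obtain ⟨t₀, ht₀⟩ := hne
  have hm_le : sInf A ≤ t₀ := csInf_le hbdd ht₀
  have hbefore : ∀ s ∈ Ico 0 (sInf A), γ s = γ' s := fun s hs => by
    by_contra hns
    exact absurd (csInf_le hbdd (show s ∈ A from ⟨⟨hs.1, (hs.2.le.trans hm_le).trans ht₀.1.2⟩, hns⟩))
      (not_le.2 hs.2)
  have hat : γ (sInf A) = γ' (sInf A) := by
    rcases hm0.eq_or_lt with h1 | h1
    · rwa [← h1]
    · exact h.eq_of_eq_before h' ⟨h1, hm_le.trans ht₀.1.2⟩ hbefore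
  have hlt : sInf A < t₀ := lt_of_le_of_ne hm_le fun h1 => ht₀.2 (h1 ▸ hat)
  have hmT : sInf A ∈ Ico 0 T := ⟨hm0, hlt.trans_le ht₀.1.2⟩
  obtain ⟨ε, hε, H⟩ := h.leaves _ hmT
  obtain ⟨ε', hε', H'⟩ := h'.leaves _ hmT
  obtain ⟨t, htA, ht⟩ := exists_lt_of_csInf_lt ⟨t₀, ht₀⟩
    (show sInf A < sInf A + min ε ε' by linarith [lt_min hε hε'])
  have hmt : sInf A < t := lt_of_le_of_ne (csInf_le hbdd htA) fun h1 => htA.2 (h1 ▸ hat)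
  refine htA.2 ?_
  have e1 := H (t - sInf A) ⟨by linarith, by linarith [min_le_left ε ε']⟩ (by linarith [htA.1.2])
  have e2 := H' (t - sInf A) ⟨by linarith, by linarith [min_le_right ε ε']⟩ (by linarith [htA.1.2])
  rw [add_sub_cancel] at e1 e2
  rw [e1, e2, hat]

lemma FirstReturn.unique {b : ℝ → ℝ} {θ : ℝ} {x x' x'' : UnitAddCircle}
    (h : FirstReturn b θ x x') (h' : FirstReturn b θ x x'') : x' = x'' := by
  obtain ⟨T, hT, γ, hγ, h0, h1, h2⟩ := h
  obtain ⟨T', hT', γ', hγ', h0', hend, h2'⟩ := h'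
  rcases lt_trichotomy T T' with hlt | rfl | hlt
  · have := hγ.eqOn (hγ'.mono hlt.le) (h0.trans h0'.symm) T ⟨hT.le, le_rfl⟩
    refine absurd ?_ (h2' T ⟨hT, hlt⟩)
    rw [← this, h1]
  · have := hγ.eqOn hγ' (h0.trans h0'.symm) T ⟨hT.le, le_rfl⟩
    rw [h1, hend] at this
    exact (Prod.mk.inj this).1
  · have := (hγ.mono hlt.le).eqOn hγ' (h0.trans h0'.symm) T' ⟨hT'.le, le_rfl⟩
    refine absurd ?_ (h2 T' ⟨hT', hlt⟩)
    rw [this, hend]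

/-- The trajectory which hits the upper boundary above `w`. -/
lemma firstReturn_pt {b : ℝ → ℝ} (hb : IsProfile b) {θ : ℝ} (hsin : 0 < Real.sin θ)
    (hcos : 0 < Real.cos θ)
    (hα : ∀ x y, x ≤ y → |roof b (pt y) - roof b (pt x)| ≤ Real.tan θ * (y - x))
    (hα' : ∀ x y, x < y → |roof b (pt y) - roof b (pt x)| < Real.tan θ * (y - x)) (w : ℝ) :
    FirstReturn b θ (pt (w - roof b (pt w) / Real.tan θ))
      (pt (w + roof b (pt w) / Real.tan θ)) := by
  set B := roof b (pt w) with hB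
  have hBpos : 0 < B := roof_pos hb w
  set T₁ := B / Real.sin θ with hT₁
  have hT₁pos : 0 < T₁ := div_pos hBpos hsin
  have hT₁sin : T₁ * Real.sin θ = B := div_mul_cancel₀ _ hsin.ne'
  have hT₁cos : T₁ * Real.cos θ = B / Real.tan θ := by
    rw [Real.tan_eq_sin_div_cos, hT₁]
    field_simp
  have htan : Real.tan θ * Real.cos θ = Real.sin θ := Real.tan_mul_cos hcos.ne'
  set x := w - B / Real.tan θ with hx
  have hxw : x + T₁ * Real.cos θ = w := by rw [hT₁cos, hx]; ring
  -- `T₁` is the time at which the roof is hit; there the height drops by `2 B`, from `B` to `-B`.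
  let γ : ℝ → UnitAddCircle × ℝ := fun t =>
    if t < T₁ then (pt (x + t * Real.cos θ), t * Real.sin θ)
    else (pt (x + t * Real.cos θ), t * Real.sin θ - 2 * B)
  have hlow : ∀ t, t < T₁ → γ t = (pt (x + t * Real.cos θ), t * Real.sin θ) :=
    fun t ht => if_pos ht
  have hhigh : ∀ t, T₁ ≤ t → γ t = (pt (x + t * Real.cos θ), t * Real.sin θ - 2 * B) :=
    fun t ht => if_neg (not_lt.2 ht)
  have hmove : ∀ s t y z, move θ s (pt (x + t * Real.cos θ), t * Real.sin θ - z) =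
      (pt (x + (t + s) * Real.cos θ), y) ↔ (t + s) * Real.sin θ - z = y := by
    intro s t y z
    have : pt (x + t * Real.cos θ) + ((s * Real.cos θ : ℝ) : UnitAddCircle) =
        pt (x + (t + s) * Real.cos θ) := by
      rw [pt, pt, ← AddCircle.coe_add]
      congr 1
      ring
    simp only [move, this, Prod.mk.injEq, true_and]
    constructor <;> intro h <;> linarith
  have hsin2 : ∀ s t : ℝ, Real.tan θ * (x + t * Real.cos θ - (x + s * Real.cos θ)) =
      (t - s) * Real.sin θ := fun s t => by rw [← htan]; ring
  refine ⟨2 * T₁, by linarith, γ, ⟨?_, ?_, ?_⟩, ?_, ?_, ?_⟩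
  · intro t ht
    rcases lt_or_ge t T₁ with h | h
    · rw [hlow t h]
      have h0 : 0 ≤ t * Real.sin θ := mul_nonneg ht.1 hsin.le
      -- The trajectory is steeper than the roof, so it stays strictly below the roof until it hits
      -- it above `w`. After the jump the non-strict bound is enough, because the lower boundary
      -- belongs to the surface.
      have h1 := (abs_lt.1 (hα' (x + t * Real.cos θ) (x + T₁ * Real.cos θ)
        (by nlinarith))).2
      rw [hsin2, hxw, ← hB, sub_mul, hT₁sin] at h1
      exact ⟨by linarith [roof_pos hb (x + t * Real.cos θ)], by
        show t * Real.sin θ < roof b (pt (x + t * Real.cos θ)); linarith⟩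
    · rw [hhigh t h]
      have h1 := (abs_le.1 (hα (x + T₁ * Real.cos θ) (x + t * Real.cos θ)
        (by nlinarith))).1
      rw [hsin2, hxw, ← hB, sub_mul, hT₁sin] at h1
      have h2 : t * Real.sin θ ≤ 2 * B := by
        rw [← hT₁sin, ← mul_assoc]
        exact mul_le_mul_of_nonneg_right ht.2 hsin.le
      refine ⟨?_, ?_⟩
      · show -roof b (pt (x + t * Real.cos θ)) ≤ t * Real.sin θ - 2 * B
        linarith
      · show t * Real.sin θ - 2 * B < roof b (pt (x + t * Real.cos θ))
        linarith [roof_pos hb (x + t * Real.cos θ)]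
  · intro t ht
    rcases lt_or_ge t T₁ with h | h
    · refine ⟨(T₁ - t) / 2, by linarith, fun s hs _ => ?_⟩
      rw [hlow t h, hlow (t + s) (by linarith [hs.2]), ← sub_zero (t * Real.sin θ), eq_comm, hmove]
      ring
    · refine ⟨1, one_pos, fun s hs _ => ?_⟩
      rw [hhigh t h, hhigh (t + s) (by linarith [hs.1]), eq_comm, hmove]
  · intro t ht
    rcases lt_trichotomy t T₁ with h | rfl | h
    · refine ⟨1, one_pos, Or.inl fun s hs _ => ?_⟩
      rw [hlow t h, hlow (t - s) (by linarith [hs.1]), ← sub_zero (t * Real.sin θ), eq_comm,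
        sub_eq_add_neg t, hmove]
      ring
    · refine ⟨1, one_pos, Or.inr ⟨?_, fun s hs _ => ?_⟩⟩
      · rw [hhigh T₁ le_rfl, hT₁sin, hxw, ← hB]
        ring
      · rw [hhigh T₁ le_rfl, hlow (T₁ - s) (by linarith [hs.1])]
        have : roof b (pt (x + T₁ * Real.cos θ)) = T₁ * Real.sin θ - 0 := by
          rw [hT₁sin, hxw, ← hB, sub_zero]
        simp only [this]
        rw [eq_comm, sub_eq_add_neg T₁, hmove]
        ring
    · refine ⟨(t - T₁) / 2, by linarith, Or.inl fun s hs _ => ?_⟩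
      rw [hhigh t h.le, hhigh (t - s) (by linarith [hs.2]), eq_comm, sub_eq_add_neg t, hmove]
  · rw [hlow 0 hT₁pos]
    simp
  · rw [hhigh _ (by linarith)]
    have h1 : x + 2 * T₁ * Real.cos θ = w + B / Real.tan θ := by
      rw [mul_assoc, hT₁cos, hx]; ring
    rw [h1, mul_assoc, hT₁sin, sub_self]
  · intro t ht
    rcases lt_or_ge t T₁ with h | h
    · rw [hlow t h]
      exact (mul_pos ht.1 hsin).ne'
    · rw [hhigh t h]
      have : t * Real.sin θ < 2 * T₁ * Real.sin θ := mul_lt_mul_of_pos_right ht.2 hsin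
      rw [mul_assoc, hT₁sin] at this
      exact (sub_neg.2 this).ne

/-! ### From lifts to circle homeomorphisms -/

/-- The map of the circle which a lift induces. -/
def circleMap (g : CircleDeg1Lift) : UnitAddCircle → UnitAddCircle :=
  Function.Periodic.lift (f := fun t : ℝ => pt (g t)) (c := (1 : ℝ)) fun t => by
    simp only [g.map_add_one, pt_add_one]

lemma circleMap_pt (g : CircleDeg1Lift) (t : ℝ) : circleMap g (pt t) = pt (g t) := rfl

lemma pt_surjective : Function.Surjective pt := QuotientAddGroup.mk_surjective

lemma continuous_pt : Continuous pt := AddCircle.continuous_mk' 1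

lemma continuous_circleMap {g : CircleDeg1Lift} (hg : Continuous g) : Continuous (circleMap g) :=
  continuous_quot_lift _ (continuous_pt.comp hg)

lemma continuous_unit (g : CircleDeg1Liftˣ) : Continuous g := by
  rw [← CircleDeg1Lift.coe_toOrderIso]
  exact OrderIso.continuous _

lemma strictMono_unit (g : CircleDeg1Liftˣ) : StrictMono g := by
  rw [← CircleDeg1Lift.coe_toOrderIso]
  exact OrderIso.strictMono _

/-- The circle homeomorphism which an invertible lift induces. -/
def circleHomeo (g : CircleDeg1Liftˣ) : UnitAddCircle ≃ₜ UnitAddCircle where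
  toFun := circleMap g
  invFun := circleMap (g⁻¹ : CircleDeg1Liftˣ)
  left_inv x := by
    obtain ⟨t, rfl⟩ := pt_surjective x
    rw [circleMap_pt, circleMap_pt, CircleDeg1Lift.units_inv_apply_apply]
  right_inv x := by
    obtain ⟨t, rfl⟩ := pt_surjective x
    rw [circleMap_pt, circleMap_pt, CircleDeg1Lift.units_apply_inv_apply]
  continuous_toFun := continuous_circleMap (continuous_unit g)
  continuous_invFun := continuous_circleMap (continuous_unit g⁻¹)

lemma circleHomeo_pt (g : CircleDeg1Liftˣ) (t : ℝ) : circleHomeo g (pt t) = pt (g t) := rfl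

lemma circleHomeo_iterate_pt (g : CircleDeg1Liftˣ) (n : ℕ) (t : ℝ) :
    (circleHomeo g)^[n] (pt t) = pt ((g ^ n : CircleDeg1Liftˣ) t) := by
  induction n with
  | zero => simp
  | succ n ih =>
    rw [Function.iterate_succ_apply', ih, circleHomeo_pt, pow_succ', Units.val_mul,
      CircleDeg1Lift.mul_apply]

lemma circleHomeo_symm_iterate_pt (g : CircleDeg1Liftˣ) (n : ℕ) (t : ℝ) :
    (circleHomeo g).symm^[n] (pt t) = pt ((g⁻¹ ^ n : CircleDeg1Liftˣ) t) :=
  circleHomeo_iterate_pt g⁻¹ n t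

/-! ### One-sided rational approximation -/

/-- Dirichlet's theorem gives a good fraction on an unspecified side of `ρ`. If it lies below, it is
replaced by a fraction above `ρ` that forms a unimodular pair with it. -/
lemma exists_int_sub_mul_lt {ρ : ℝ} (hρ : Irrational ρ) {ε : ℝ} (hε : 0 < ε) :
    ∃ (p : ℤ) (q : ℕ), 0 < q ∧ IsCoprime p (q : ℤ) ∧ 0 < p - q * ρ ∧ p - q * ρ < ε ∧
      q * (p - q * ρ) < 1 := by
  obtain ⟨n, hn⟩ := exists_nat_one_div_lt hε
  obtain ⟨r, hr, hrn⟩ := Real.exists_rat_abs_sub_le_and_den_le ρ (Nat.succ_pos n)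
  have hden : (0 : ℝ) < r.den := by exact_mod_cast r.den_pos
  have hcop : IsCoprime r.num (r.den : ℤ) := Int.isCoprime_iff_gcd_eq_one.2 r.reduced
  have hrq : (r : ℝ) = r.num / r.den := Rat.cast_def r
  have hrn' : (r.den : ℝ) < n + 1 + 1 := by
    have : (r.den : ℝ) ≤ (n + 1 : ℕ) := by exact_mod_cast hrn
    push_cast at this
    linarith
  have habs : |r.num - r.den * ρ| ≤ 1 / (n + 1 + 1) := by
    have h1 : r.num - r.den * ρ = -((ρ - r) * r.den) := by rw [hrq]; field_simp; ring
    rw [h1, abs_neg, abs_mul, abs_of_pos hden]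
    calc |ρ - r| * r.den ≤ 1 / (((n + 1 : ℕ) + 1) * r.den) * r.den := by gcongr
      _ = 1 / (n + 1 + 1) := by push_cast; field_simp
  have hsmall : (1 : ℝ) / (n + 1 + 1) < ε := by
    refine lt_trans ?_ hn
    apply one_div_lt_one_div_of_lt <;> linarith [(Nat.cast_nonneg n : (0 : ℝ) ≤ n)]
  have hmul : r.den * |r.num - r.den * ρ| < 1 := by
    calc r.den * |r.num - r.den * ρ| ≤ r.den * (1 / (n + 1 + 1)) := by gcongr
      _ < 1 := by rw [mul_one_div, div_lt_one (by positivity)]; exact hrn'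
  have hne : (r.num : ℝ) - r.den * ρ ≠ 0 := fun h => by
    refine hρ ⟨r, ?_⟩
    rw [hrq, div_eq_iff hden.ne']
    linarith
  rcases hne.lt_or_gt with hneg | hpos
  · rw [abs_of_neg hneg] at habs hmul
    obtain ⟨u, v, huv⟩ := hcop
    set e : ℝ := -(r.num - r.den * ρ) with he
    have he0 : 0 < e := by linarith
    set x₀ : ℝ := v + u * ρ with hx₀
    -- The candidates `(v + k * r.num) / (-u + k * r.den)` all have determinant `1` with `r`, and
    -- their errors are `x₀ - k e`. The largest `k` with positive error makes that error at most
    -- `e`.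
    set k : ℤ := ⌈x₀ / e⌉ - 1 with hk
    have hk1 : x₀ ≤ (k + 1) * e := by
      rw [← div_le_iff₀ he0, hk]
      push_cast
      linarith [Int.le_ceil (x₀ / e)]
    have hk2 : k * e < x₀ := by
      rw [← lt_div_iff₀ he0, hk]
      push_cast
      linarith [Int.ceil_lt_add_one (x₀ / e)]
    set d : ℤ := -u + k * r.den with hd
    have hdx : ((v + k * r.num : ℤ) : ℝ) - d * ρ = x₀ - k * e := by
      rw [hd, hx₀, he]
      push_cast
      ring
    have huv' : (u : ℝ) * r.num + v * r.den = 1 := by exact_mod_cast huv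
    -- The determinant identity, in terms of the two errors. Its first term is positive and below
    -- `1`, so `d` is positive and `d * e < 1`.
    have h1 : r.den * (x₀ - k * e) + d * e = 1 := by
      rw [← huv', hd, hx₀, he]
      push_cast
      ring
    have h2 : (r.den : ℝ) * (x₀ - k * e) ≤ r.den * e :=
      mul_le_mul_of_nonneg_left (by linarith) hden.le
    have hd0 : (0 : ℝ) < d := by
      by_contra hcon
      nlinarith
    have hd0' : 0 < d := by exact_mod_cast hd0
    have hcast : ((d.toNat : ℕ) : ℤ) = d := Int.toNat_of_nonneg hd0'.le
    have hcast' : ((d.toNat : ℕ) : ℝ) = d := by exact_mod_cast hcast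
    refine ⟨v + k * r.num, d.toNat, by omega, ?_, ?_⟩
    · rw [hcast]
      refine ⟨r.den, -r.num, ?_⟩
      rw [hd, ← huv]
      ring
    · rw [hcast', hdx]
      refine ⟨by linarith, by linarith, ?_⟩
      have h3 : (d : ℝ) * (x₀ - k * e) ≤ d * e := mul_le_mul_of_nonneg_left (by linarith) hd0.le
      have h4 : 0 < (r.den : ℝ) * (x₀ - k * e) := mul_pos hden (by linarith)
      linarith
  · rw [abs_of_pos hpos] at habs hmul
    exact ⟨r.num, r.den, r.den_pos, hcop, hpos, by linarith, hmul⟩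

lemma exists_int_sub_mul_lt_of_large {ρ : ℝ} (hρ : Irrational ρ) (N : ℕ) :
    ∃ (p : ℤ) (q : ℕ), N < q ∧ IsCoprime p (q : ℤ) ∧ 0 < p - q * ρ ∧ q * (p - q * ρ) < 1 := by
  -- A positive value of `p - q ρ` is at least the fractional part of `-q ρ`; an `ε` below these
  -- parts for all `q ≤ N` forces a larger denominator.
  have hev : ∀ᶠ ε : ℝ in 𝓝[>] 0, ∀ q ∈ Finset.Icc 1 N, ε < Int.fract (-(q * ρ)) := by
    refine (Filter.eventually_all_finset _).2 fun q hq => ?_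
    have hq0 : q ≠ 0 := by
      have := (Finset.mem_Icc.1 hq).1
      omega
    have hirr : Irrational (-(q * ρ)) := (hρ.natCast_mul hq0).neg
    have : 0 < Int.fract (-(q * ρ)) := Int.fract_pos.2 (hirr.ne_int _)
    filter_upwards [Ioo_mem_nhdsGT this] with ε hε using hε.2
  obtain ⟨ε, hε, hε0⟩ := (hev.and self_mem_nhdsWithin).exists
  obtain ⟨p, q, hq, hcop, h0, h1, h2⟩ := exists_int_sub_mul_lt hρ hε0
  refine ⟨p, q, ?_, hcop, h0, h2⟩
  by_contra! hqN
  have h3 := hε q (Finset.mem_Icc.2 ⟨hq, hqN⟩)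
  have h4 : Int.fract (-(q * ρ)) ≤ p - q * ρ := by
    have : Int.fract (-(q * ρ)) = Int.fract (p - q * ρ) := by
      rw [sub_eq_add_neg, add_comm, Int.fract_add_intCast]
    rw [this]
    have h5 : (0 : ℝ) ≤ ⌊(p : ℝ) - q * ρ⌋ := by exact_mod_cast Int.floor_nonneg.2 h0.le
    linarith [Int.self_sub_floor ((p : ℝ) - q * ρ)]
  linarith

/-- Among `q` consecutive points of an orbit of the rotation by `ρ`, where `p / q` is a good
rational approximation of `ρ` from above, at most two lie in an arc of length `p - q ρ`. -/
lemma card_le_two_of_approx {ρ h : ℝ} {p : ℤ} {q : ℕ} (hcop : IsCoprime p (q : ℤ))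
    (hδ : 0 < p - q * ρ) (hqδ : q * (p - q * ρ) < 1) {s : Finset ℕ} (hs : ∀ j ∈ s, j < q)
    (hh : ∀ j ∈ s, ∃ m : ℤ, h - j * ρ - m ∈ Icc 0 (p - q * ρ)) : s.card ≤ 2 := by
  choose! m hm using hh
  have hq : ∀ j ∈ s, (0 : ℝ) < q := fun j hj => by exact_mod_cast (Nat.zero_le j).trans_lt (hs j hj)
  have : ({⌊q * h⌋, ⌊q * h⌋ + 1} : Finset ℤ).card ≤ 2 := Finset.card_le_two
  -- The rotation by `ρ` is compared with the one by `p / q`: the integer `j p + q m` differs from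
  -- `q h` by less than `1`, since both error terms lie in `[0, 1)`. It determines `j` because `p`
  -- is invertible modulo `q`.
  refine le_trans (Finset.card_le_card_of_injOn (fun j => j * p + q * m j) ?_ ?_) this
  · intro j hj
    have hjq : (j : ℝ) ≤ q := by exact_mod_cast (hs j hj).le
    have hN : ((j * p + q * m j : ℤ) : ℝ) =
        q * h + j * (p - q * ρ) - q * (h - j * ρ - m j) := by
      push_cast
      ring
    have h1 : (j : ℝ) * (p - q * ρ) ≤ q * (p - q * ρ) := mul_le_mul_of_nonneg_right hjq hδ.le
    have h2 : q * (h - j * ρ - m j) ≤ q * (p - q * ρ) :=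
      mul_le_mul_of_nonneg_left (hm j hj).2 (hq j hj).le
    have h3 : 0 ≤ q * (h - j * ρ - m j) := mul_nonneg (hq j hj).le (hm j hj).1
    have h4 : 0 ≤ (j : ℝ) * (p - q * ρ) := mul_nonneg (Nat.cast_nonneg j) hδ.le
    have h5 : ⌊q * h⌋ - 1 < (j * p + q * m j : ℤ) := by
      have : ((⌊q * h⌋ - 1 : ℤ) : ℝ) < ((j * p + q * m j : ℤ) : ℝ) := by
        rw [hN]
        push_cast
        linarith [Int.floor_le (q * h)]
      exact_mod_cast this
    have h6 : (j * p + q * m j : ℤ) < ⌊q * h⌋ + 2 := by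
      have : ((j * p + q * m j : ℤ) : ℝ) < ((⌊q * h⌋ + 2 : ℤ) : ℝ) := by
        rw [hN]
        push_cast
        linarith [Int.lt_floor_add_one (q * h)]
      exact_mod_cast this
    simp only [Finset.coe_insert, Finset.coe_singleton, mem_insert_iff, mem_singleton_iff]
    omega
  · intro j hj j' hj' heq
    have hdvd : (q : ℤ) ∣ (j - j') * p := ⟨m j' - m j, by
      simp only at heq
      linear_combination heq⟩
    have hdvd' := hcop.symm.dvd_of_dvd_mul_right hdvd
    have h1 := hs j hj
    have h2 := hs j' hj'
    have h3 : ((j : ℤ) - j') = 0 := by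
      refine Int.eq_zero_of_abs_lt_dvd hdvd' ?_
      rw [abs_lt]
      omega
    omega

/-! ### Absence of wandering intervals -/

/-- Telescoping of `L' j / L j`, written without divisions: this ratio does not grow at a good step
and grows at most by the factor `C` at a bad one. -/
lemma mul_le_pow_card_mul {L L' : ℕ → ℝ} (hL : ∀ j, 0 < L j) (hL' : ∀ j, 0 < L' j) {C : ℝ}
    (P : ℕ → Prop) [DecidablePred P] (q : ℕ)
    (hC : ∀ j, L' (j + 1) * L j ≤ C * (L (j + 1) * L' j))
    (h : ∀ j < q, ¬P j → L' (j + 1) * L j ≤ L (j + 1) * L' j) :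
    ∀ m ≤ q, L' m * L 0 ≤ C ^ ((Finset.range m).filter P).card * (L m * L' 0) := by
  have hC0 : 0 ≤ C := by
    have h1 := (mul_pos (hL' 1) (hL 0)).trans_le (hC 0)
    exact (pos_of_mul_pos_left h1 (mul_pos (hL 1) (hL' 0)).le).le
  intro m
  induction m with
  | zero => intro _; simp [mul_comm]
  | succ m ih =>
    intro hm
    have ih := ih (by omega)
    have hpos := mul_pos (hL m) (hL' m)
    have h0 := mul_pos (hL' m) (hL 0)
    have h1 := mul_pos (hL' (m + 1)) (hL m)
    refine le_of_mul_le_mul_right ?_ hpos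
    rw [Finset.range_add_one, Finset.filter_insert]
    split_ifs with hP
    · rw [Finset.card_insert_of_notMem (by simp), pow_succ]
      calc L' (m + 1) * L 0 * (L m * L' m) = (L' (m + 1) * L m) * (L' m * L 0) := by ring
        _ ≤ (C * (L (m + 1) * L' m)) *
            (C ^ ((Finset.range m).filter P).card * (L m * L' 0)) :=
          mul_le_mul (hC m) ih h0.le (h1.le.trans (hC m))
        _ = _ := by ring
    · calc L' (m + 1) * L 0 * (L m * L' m) = (L' (m + 1) * L m) * (L' m * L 0) := by ring
        _ ≤ (L (m + 1) * L' m) * (C ^ ((Finset.range m).filter P).card * (L m * L' 0)) :=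
          mul_le_mul (h m (by omega) hP) ih h0.le (h1.le.trans (h m (by omega) hP))
        _ = _ := by ring

lemma concaveOn_add_int {g : CircleDeg1Lift} {c : ℝ} (h : ConcaveOn ℝ (Icc c (c + 1)) g) (m : ℤ) :
    ConcaveOn ℝ (Icc (c + m) (c + m + 1)) g := by
  refine ⟨convex_Icc _ _, fun x hx y hy a b ha hb hab => ?_⟩
  have hx' : x - m ∈ Icc c (c + 1) := ⟨by linarith [hx.1], by linarith [hx.2]⟩
  have hy' : y - m ∈ Icc c (c + 1) := ⟨by linarith [hy.1], by linarith [hy.2]⟩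
  have := h.2 hx' hy' ha hb hab
  have e : a • (x - m) + b • (y - m) = a • x + b • y - m := by
    simp only [smul_eq_mul]
    linear_combination (-(m : ℝ)) * hab
  rw [e, g.map_sub_int, g.map_sub_int, g.map_sub_int] at this
  simp only [smul_eq_mul] at this ⊢
  have e2 : a * (g x - m) + b * (g y - m) = a * g x + b * g y - m := by
    linear_combination (-(m : ℝ)) * hab
  linarith

lemma _root_.ConcaveOn.mul_sub_le_mul_sub {f : ℝ → ℝ} {s : Set ℝ} (hf : ConcaveOn ℝ s f) {x y z w : ℝ}
    (hx : x ∈ s) (hw : w ∈ s) (hxy : x < y) (hyz : y < z) (hzw : z < w) :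
    (f w - f z) * (y - x) ≤ (f y - f x) * (w - z) := by
  have hy : y ∈ s := hf.1.ordConnected.out hx hw ⟨hxy.le, (hyz.trans hzw).le⟩
  have hz : z ∈ s := hf.1.ordConnected.out hx hw ⟨(hxy.trans hyz).le, hzw.le⟩
  have h1 := hf.slope_anti_adjacent hx hz hxy hyz
  have h2 := hf.slope_anti_adjacent hy hw hyz hzw
  have h3 := h2.trans h1
  rwa [div_le_div_iff₀ (by linarith) (by linarith)] at h3

lemma unit_mul_apply (g h : CircleDeg1Liftˣ) (x : ℝ) :
    (g * h : CircleDeg1Liftˣ) x = g (h x) := rfl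

/-- A monotone map of degree one which conjugates the lift `g` with a translation. -/
lemma semiconj_zpow_apply {g : CircleDeg1Liftˣ} {H : CircleDeg1Lift} {ρ : ℝ}
    (hH : ∀ x, H (g x) = H x + ρ) (n : ℤ) (x : ℝ) :
    H ((g ^ n : CircleDeg1Liftˣ) x) = H x + n * ρ := by
  induction n using Int.induction_on with
  | zero => simp
  | succ n ih =>
    rw [add_comm, zpow_add, zpow_one, unit_mul_apply, hH, ih]
    push_cast
    ring
  | pred n ih =>
    have h1 := hH ((g ^ (-(n : ℤ) - 1) : CircleDeg1Liftˣ) x)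
    rw [← unit_mul_apply, ← zpow_one_add, add_sub_cancel, ih] at h1
    push_cast at h1 ⊢
    linarith

/-- `H` is constant on each image of `[a, b]`, so by irrationality distinct images are disjoint
modulo `1`, and only finitely many of them can be long. -/
lemma finite_setOf_le_length {g : CircleDeg1Liftˣ} {H : CircleDeg1Lift} {ρ : ℝ}
    (hρ : Irrational ρ) (hH : ∀ x, H (g x) = H x + ρ) {a b : ℝ} (hab : H a = H b) {η : ℝ}
    (hη : 0 < η) :
    {n : ℤ | η ≤ (g ^ n : CircleDeg1Liftˣ) b - (g ^ n : CircleDeg1Liftˣ) a}.Finite := by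
  by_contra hinf
  -- Pigeonhole on cells of width `η` in the circle: two long images whose left endpoints share a
  -- cell must overlap.
  have hmaps : MapsTo (fun n : ℤ => ⌊Int.fract ((g ^ n : CircleDeg1Liftˣ) a) / η⌋)
      {n : ℤ | η ≤ (g ^ n : CircleDeg1Liftˣ) b - (g ^ n : CircleDeg1Liftˣ) a}
      (Icc 0 ⌊1 / η⌋) := by
    intro n _
    refine ⟨Int.floor_nonneg.2 (div_nonneg (Int.fract_nonneg _) hη.le), Int.floor_le_floor ?_⟩
    exact div_le_div_of_nonneg_right (Int.fract_lt_one _).le hη.le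
  obtain ⟨n, hn, n', hn', hne, heq⟩ :=
    Set.Infinite.exists_ne_map_eq_of_mapsTo hinf hmaps (finite_Icc _ _)
  have hlt := Int.abs_sub_lt_one_of_floor_eq_floor heq
  rw [← sub_div, abs_div, abs_of_pos hη, div_lt_one hη] at hlt
  wlog hle : Int.fract ((g ^ n' : CircleDeg1Liftˣ) a) ≤ Int.fract ((g ^ n : CircleDeg1Liftˣ) a)
    generalizing n n'
  · exact this n' hn' n hn hne.symm heq.symm (by rwa [abs_sub_comm]) (le_of_not_ge hle)
  rw [abs_of_nonneg (sub_nonneg.2 hle)] at hlt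
  set m := ⌊(g ^ n : CircleDeg1Liftˣ) a⌋ with hm
  set m' := ⌊(g ^ n' : CircleDeg1Liftˣ) a⌋ with hm'
  have e1 := Int.self_sub_floor ((g ^ n : CircleDeg1Liftˣ) a)
  have e2 := Int.self_sub_floor ((g ^ n' : CircleDeg1Liftˣ) a)
  simp only [mem_ofPred_eq] at hn'
  have h1 : H ((g ^ n' : CircleDeg1Liftˣ) a - m') ≤ H ((g ^ n : CircleDeg1Liftˣ) a - m) :=
    H.monotone (by linarith)
  have h2 : H ((g ^ n : CircleDeg1Liftˣ) a - m) ≤ H ((g ^ n' : CircleDeg1Liftˣ) b - m') :=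
    H.monotone (by linarith)
  rw [H.map_sub_int, H.map_sub_int, semiconj_zpow_apply hH, semiconj_zpow_apply hH] at h1 h2
  rw [← hab] at h2
  have h3 : ((n - n' : ℤ) : ℝ) * ρ = (m - m' : ℤ) := by
    push_cast
    linarith
  exact (hρ.intCast_mul (sub_ne_zero.2 hne)).ne_int _ h3

/-- The estimate behind Denjoy's theorem: if `g` is concave outside of one point, then a wandering
interval cannot become short both in the future and in the past. -/
lemma sq_length_le {g : CircleDeg1Liftˣ} {c K : ℝ} (hK : 0 < K)
    (hconc : ConcaveOn ℝ (Icc c (c + 1)) g)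
    (hlow : ∀ x y, x ≤ y → y - x ≤ K * (g y - g x))
    (hup : ∀ x y, x ≤ y → g y - g x ≤ K * (y - x))
    {H : CircleDeg1Lift} {ρ : ℝ} (hH : ∀ x, H (g x) = H x + ρ) {a b : ℝ} (hab : a < b)
    (hHab : H a = H b) {p : ℤ} {q : ℕ} (hcop : IsCoprime p (q : ℤ))
    (hδ : 0 < p - q * ρ) (hqδ : q * (p - q * ρ) < 1) :
    (b - a) ^ 2 ≤ (K ^ 2) ^ 2 *
      (((g ^ (q : ℤ) : CircleDeg1Liftˣ) b - (g ^ (q : ℤ) : CircleDeg1Liftˣ) a) *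
        ((g ^ (-q : ℤ) : CircleDeg1Liftˣ) b - (g ^ (-q : ℤ) : CircleDeg1Liftˣ) a)) := by
  classical
  have hK1 : 1 ≤ K ^ 2 := by
    have h1 := hlow 0 1 zero_le_one
    have h2 := mul_le_mul_of_nonneg_left (hup 0 1 zero_le_one) hK.le
    nlinarith
  -- Two stretches of the orbit of the interval are run in parallel: from time `0` to `q`, and from
  -- time `-q` to `0`. The end of the second is the start of the first.
  let L : ℕ → ℝ := fun j => (g ^ (j : ℤ) : CircleDeg1Liftˣ) b - (g ^ (j : ℤ) : CircleDeg1Liftˣ) a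
  let L' : ℕ → ℝ := fun j =>
    (g ^ (j - q : ℤ) : CircleDeg1Liftˣ) b - (g ^ (j - q : ℤ) : CircleDeg1Liftˣ) a
  have hL : ∀ j, 0 < L j := fun j => sub_pos.2 (strictMono_unit _ hab)
  have hL' : ∀ j, 0 < L' j := fun j => sub_pos.2 (strictMono_unit _ hab)
  have hsucc : ∀ (n : ℤ) (x : ℝ),
      (g ^ (n + 1) : CircleDeg1Liftˣ) x = g ((g ^ n : CircleDeg1Liftˣ) x) := fun n x => by
    rw [add_comm, zpow_one_add, unit_mul_apply]
  have hLs : ∀ j : ℕ, L (j + 1) =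
      g ((g ^ (j : ℤ) : CircleDeg1Liftˣ) b) - g ((g ^ (j : ℤ) : CircleDeg1Liftˣ) a) := fun j => by
    simp only [L, Nat.cast_add, Nat.cast_one, hsucc]
  have hLs' : ∀ j : ℕ, L' (j + 1) =
      g ((g ^ (j - q : ℤ) : CircleDeg1Liftˣ) b) -
        g ((g ^ (j - q : ℤ) : CircleDeg1Liftˣ) a) := fun j => by
    simp only [L', Nat.cast_add, Nat.cast_one, add_sub_right_comm, hsucc]
  -- The bad times: a break point of `g` lies in the hull of the two compared intervals.
  let P : ℕ → Prop := fun j => ∃ m : ℤ, c + m ∈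
    Icc ((g ^ (j : ℤ) : CircleDeg1Liftˣ) a) ((g ^ (j - q : ℤ) : CircleDeg1Liftˣ) b + p)
  have hC : ∀ j, L' (j + 1) * L j ≤ K ^ 2 * (L (j + 1) * L' j) := by
    intro j
    have h1 : L' (j + 1) ≤ K * L' j := by
      rw [hLs']; exact hup _ _ (strictMono_unit _ hab).le
    have h2 : L j ≤ K * L (j + 1) := by
      rw [hLs]; exact hlow _ _ (strictMono_unit _ hab).le
    calc L' (j + 1) * L j ≤ (K * L' j) * (K * L (j + 1)) :=
          mul_le_mul h1 h2 (hL j).le (mul_pos hK (hL' j)).le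
      _ = _ := by ring
  have hnot : ∀ j < q, ¬P j → L' (j + 1) * L j ≤ L (j + 1) * L' j := by
    intro j hj hP
    set A := (g ^ (j : ℤ) : CircleDeg1Liftˣ) a with hA
    set B := (g ^ (j : ℤ) : CircleDeg1Liftˣ) b with hB
    set A' := (g ^ (j - q : ℤ) : CircleDeg1Liftˣ) a with hA'
    set B' := (g ^ (j - q : ℤ) : CircleDeg1Liftˣ) b with hB'
    have hAB : A < B := strictMono_unit _ hab
    have hAB' : A' < B' := strictMono_unit _ hab
    -- In the coordinate `H` the shifted interval lies exactly `p - q ρ > 0` further to the right.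
    have hBA' : B < A' + p := by
      refine H.monotone.reflect_lt ?_
      rw [H.map_add_int, hA', hB, semiconj_zpow_apply hH, semiconj_zpow_apply hH, hHab]
      push_cast
      linarith
    have hm1 := Int.floor_le (A - c)
    have hm2 := Int.lt_floor_add_one (A - c)
    have hm3 : B' + p ≤ c + ⌊A - c⌋ + 1 := by
      by_contra! hcon
      refine hP ⟨⌊A - c⌋ + 1, ?_, ?_⟩
      · push_cast; linarith
      · push_cast; linarith
    have hc := concaveOn_add_int hconc ⌊A - c⌋
    have := hc.mul_sub_le_mul_sub (x := A) (y := B) (z := A' + p) (w := B' + p)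
      ⟨by linarith, by linarith⟩ ⟨by linarith, hm3⟩ hAB hBA' (by linarith)
    rw [CircleDeg1Lift.map_add_int, CircleDeg1Lift.map_add_int, add_sub_add_right_eq_sub,
      add_sub_add_right_eq_sub] at this
    rw [hLs, hLs']
    exact this
  have hmain := mul_le_pow_card_mul hL hL' P q hC hnot q le_rfl
  -- Under `H`, the hull of the two intervals becomes an arc of length `p - q ρ` starting at `H a +
  -- j ρ`.
  have hcard : ((Finset.range q).filter P).card ≤ 2 := by
    refine card_le_two_of_approx (h := H c - H a) hcop hδ hqδ
      (fun j hj => Finset.mem_range.1 (Finset.mem_filter.1 hj).1) fun j hj => ?_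
    obtain ⟨m, h1, h2⟩ := (Finset.mem_filter.1 hj).2
    have h1 := H.monotone h1
    have h2 := H.monotone h2
    rw [H.map_add_int, semiconj_zpow_apply hH] at h1
    rw [H.map_add_int, H.map_add_int, semiconj_zpow_apply hH, ← hHab] at h2
    refine ⟨-m, ?_, ?_⟩
    · push_cast at h1 ⊢
      linarith
    · push_cast at h2 ⊢
      linarith
  have hL'q : L' q = b - a := by simp [L']
  have hL0 : L 0 = b - a := by simp [L]
  have hL'0 : L' 0 =
      (g ^ (-q : ℤ) : CircleDeg1Liftˣ) b - (g ^ (-q : ℤ) : CircleDeg1Liftˣ) a := by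
    simp only [L', Nat.cast_zero, zero_sub]
  rw [hL'q, hL0, ← sq, hL'0] at hmain
  refine hmain.trans ?_
  rw [← hL'0]
  exact mul_le_mul_of_nonneg_right (pow_le_pow_right₀ hK1 hcard) (mul_pos (hL q) (hL' 0)).le

lemma semiconj_injective {g : CircleDeg1Liftˣ} {c K : ℝ} (hK : 0 < K)
    (hconc : ConcaveOn ℝ (Icc c (c + 1)) g)
    (hlow : ∀ x y, x ≤ y → y - x ≤ K * (g y - g x))
    (hup : ∀ x y, x ≤ y → g y - g x ≤ K * (y - x))
    {H : CircleDeg1Lift} {ρ : ℝ} (hρ : Irrational ρ) (hH : ∀ x, H (g x) = H x + ρ) :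
    Function.Injective H := by
  intro a b hHab
  by_contra hne
  wlog hab : a < b generalizing a b
  · exact this hHab.symm (Ne.symm hne) (lt_of_le_of_ne (not_lt.1 hab) (Ne.symm hne))
  -- Chosen so that `K⁴ η² = (b - a)² / 4`, which is incompatible with the bound of `sq_length_le`.
  set η : ℝ := (b - a) / (2 * K ^ 2) with hη
  have hη0 : 0 < η := div_pos (sub_pos.2 hab) (by positivity)
  obtain ⟨M, hM⟩ := (finite_setOf_le_length hρ hH hHab hη0).bddAbove
  obtain ⟨M', hM'⟩ := (finite_setOf_le_length hρ hH hHab hη0).bddBelow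
  obtain ⟨p, q, hq, hcop, hδ, hqδ⟩ := exists_int_sub_mul_lt_of_large hρ (M.toNat + M'.natAbs)
  have h1 := sq_length_le hK hconc hlow hup hH hab hHab hcop hδ hqδ
  have h2 : (g ^ (q : ℤ) : CircleDeg1Liftˣ) b - (g ^ (q : ℤ) : CircleDeg1Liftˣ) a < η := by
    by_contra! hcon
    have := hM hcon
    omega
  have h3 : (g ^ (-q : ℤ) : CircleDeg1Liftˣ) b - (g ^ (-q : ℤ) : CircleDeg1Liftˣ) a < η := by
    by_contra! hcon
    have := hM' hcon
    omega
  have h4 : (b - a) ^ 2 ≤ (K ^ 2) ^ 2 * (η * η) := by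
    refine h1.trans (mul_le_mul_of_nonneg_left ?_ (by positivity))
    exact mul_le_mul h2.le h3.le (sub_pos.2 (strictMono_unit _ hab)).le hη0.le
  have h5 : (K ^ 2) ^ 2 * (η * η) = (b - a) ^ 2 / 4 := by
    rw [hη]; field_simp; norm_num
  have h6 : 0 < (b - a) ^ 2 := by have := sub_pos.2 hab; positivity
  linarith

/-- Denjoy's theorem for circle homeomorphisms which are concave outside of one point. -/
lemma exists_conj_rotation {g : CircleDeg1Liftˣ} {c K : ℝ} (hK : 0 < K)
    (hconc : ConcaveOn ℝ (Icc c (c + 1)) g)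
    (hlow : ∀ x y, x ≤ y → y - x ≤ K * (g y - g x))
    (hup : ∀ x y, x ≤ y → g y - g x ≤ K * (y - x))
    (hρ : Irrational (CircleDeg1Lift.translationNumber g)) :
    ∃ h : UnitAddCircle ≃ₜ UnitAddCircle, ∀ x,
      h (circleHomeo g x) = h x + pt (CircleDeg1Lift.translationNumber g) := by
  set ρ := CircleDeg1Lift.translationNumber g with hρdef
  obtain ⟨H, hsemi⟩ := CircleDeg1Lift.units_semiconj_of_translationNumber_eq (f₁ := g)
    (f₂ := CircleDeg1Lift.translate (Multiplicative.ofAdd ρ))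
    (by rw [CircleDeg1Lift.translationNumber_translate])
  have hH : ∀ x, H (g x) = H x + ρ := fun x => by
    rw [hsemi x, CircleDeg1Lift.translate_apply, add_comm]
  have hinj := semiconj_injective hK hconc hlow hup hρ hH
  -- The values of `H` contain `H 0 + m ρ + n` for all integers `m`, `n`. A monotone map with dense
  -- range is continuous, and then surjective by degree one.
  have hdense : DenseRange H := by
    have h1 : Dense (AddSubgroup.closure {ρ, 1} : Set ℝ) := by
      rw [dense_addSubgroupClosure_pair_iff, div_one]
      exact hρ
    have h2 : DenseRange (fun x : ℝ => H 0 + x) := (Homeomorph.addLeft (H 0)).surjective.denseRange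
    have h3 := h2.dense_image (Homeomorph.addLeft (H 0)).continuous h1
    refine h3.mono ?_
    rintro _ ⟨x, hx, rfl⟩
    obtain ⟨m, n, rfl⟩ := AddSubgroup.mem_closure_pair.1 hx
    refine ⟨(g ^ m : CircleDeg1Liftˣ) 0 + n, ?_⟩
    rw [H.map_add_int, semiconj_zpow_apply hH]
    simp only [zsmul_eq_mul, mul_one]
    ring
  have hcont : Continuous H := H.monotone.continuous_of_denseRange hdense
  obtain ⟨u, hu⟩ := CircleDeg1Lift.isUnit_iff_bijective.2
    ⟨hinj, H.continuous_iff_surjective.1 hcont⟩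
  refine ⟨circleHomeo u, fun x => ?_⟩
  obtain ⟨t, rfl⟩ := pt_surjective x
  rw [circleHomeo_pt, circleHomeo_pt, circleHomeo_pt, hu, hH]
  exact AddCircle.coe_add _ _ _

lemma dense_orbit_of_conj_rotation {f h : UnitAddCircle ≃ₜ UnitAddCircle} {ρ : ℝ}
    (hρ : Irrational ρ) (hconj : ∀ x, h (f x) = h x + pt ρ) (x : UnitAddCircle) :
    Dense (range fun n : ℕ => f^[n] x) := by
  have hiter : ∀ n : ℕ, h (f^[n] x) = h x + n • pt ρ := by
    intro n
    induction n with
    | zero => simp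
    | succ n ih => rw [Function.iterate_succ_apply', hconj, ih, succ_nsmul, add_assoc]
  have h1 : DenseRange (fun n : ℕ => n • pt ρ) := by
    have hz : DenseRange (fun n : ℤ => n • (ρ : UnitAddCircle)) :=
      AddCircle.denseRange_zsmul_coe_iff.2 (by simpa using hρ)
    intro y
    -- In a compact group the multiples by natural numbers have the same closure as those by all
    -- integers.
    exact ((mapClusterPt_atTop_nsmul_tfae y (pt ρ)).out 2 3).2 (hz y)
  have h2 : DenseRange (fun y : UnitAddCircle => h.symm (h x + y)) :=
    (h.symm.surjective.comp (Homeomorph.addLeft (h x)).surjective).denseRange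
  have h3 := h2.comp h1 (h.symm.continuous.comp (Homeomorph.addLeft (h x)).continuous)
  have h4 : (fun n : ℕ => f^[n] x) =
      (fun y : UnitAddCircle => h.symm (h x + y)) ∘ fun n : ℕ => n • pt ρ := by
    funext n
    rw [Function.comp_apply, ← hiter, h.symm_apply_apply]
  rw [h4]
  exact h3

/-! ### Rational rotation number: the orbit structure of the periodic points -/

lemma zpow_apply_eq_of_forall_apply_eq {A B : CircleDeg1Liftˣ} {Z : Set ℝ}
    (hB : ∀ n : ℤ, ∀ z ∈ Z, (B ^ n : CircleDeg1Liftˣ) z ∈ Z) (hAB : ∀ z ∈ Z, A z = B z) (n : ℤ)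
    {z : ℝ} (hz : z ∈ Z) : (A ^ n : CircleDeg1Liftˣ) z = (B ^ n : CircleDeg1Liftˣ) z := by
  induction n using Int.induction_on with
  | zero => simp
  | succ n ih =>
    rw [add_comm, zpow_one_add, zpow_one_add, unit_mul_apply, unit_mul_apply, ih]
    exact hAB _ (hB _ z hz)
  | pred n ih =>
    refine (strictMono_unit A).injective ?_
    rw [hAB _ (hB _ z hz), ← unit_mul_apply, ← unit_mul_apply, ← zpow_one_add, ← zpow_one_add,
      add_sub_cancel, ih]

lemma zpow_apply_eq_self {A : CircleDeg1Liftˣ} {z : ℝ} (hz : A z = z) (n : ℤ) :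
    (A ^ n : CircleDeg1Liftˣ) z = z := by
  have := zpow_apply_eq_of_forall_apply_eq (A := A) (B := 1) (Z := {z}) (by simp)
    (by simpa using hz) n (mem_singleton z)
  simpa using this

/-- The translation by `1`. -/
def turn : CircleDeg1Liftˣ := CircleDeg1Lift.translate (Multiplicative.ofAdd 1)

lemma turn_zpow_apply (m : ℤ) (x : ℝ) : (turn ^ m : CircleDeg1Liftˣ) x = x + m := by
  rw [turn, CircleDeg1Lift.translate_zpow, CircleDeg1Lift.translate_apply, mul_one, add_comm]

lemma commute_turn (g : CircleDeg1Liftˣ) : Commute g turn := by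
  refine Units.ext (CircleDeg1Lift.ext fun x => ?_)
  have h := fun y => turn_zpow_apply 1 y
  rw [zpow_one] at h
  rw [unit_mul_apply, unit_mul_apply, h, h, CircleDeg1Lift.map_add_int]

/-- The `q`-th iterate of `g`, normalised by a translation: its fixed points are the lifts of the
`q`-periodic points if the rotation number is `p / q`. -/
def returnLift (g : CircleDeg1Liftˣ) (p q : ℕ) : CircleDeg1Liftˣ :=
  g ^ (q : ℤ) * turn ^ (-p : ℤ)

lemma returnLift_apply (g : CircleDeg1Liftˣ) (p q : ℕ) (x : ℝ) :
    returnLift g p q x = (g ^ q : CircleDeg1Liftˣ) x - p := by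
  rw [returnLift, unit_mul_apply, turn_zpow_apply, CircleDeg1Lift.map_add_int, zpow_natCast]
  push_cast
  ring

/-- The lifts of the periodic points are permuted by `S` in their order along each orbit:
`S` commutes with `g`, moves points to the right, and `g` acts on the periodic points as `S ^ p`,
while `S ^ q` is one full turn. -/
structure IsSuccessor (g S : CircleDeg1Liftˣ) (p q : ℕ) : Prop where
  pos : 0 < q
  coprime : IsCoprime (p : ℤ) (q : ℤ)
  commute : Commute S g
  lt : ∀ x, x < S x
  pow_left : ∀ z, returnLift g p q z = z → g z = (S ^ (p : ℤ) : CircleDeg1Liftˣ) z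
  pow_right : ∀ z, returnLift g p q z = z → (S ^ (q : ℤ) : CircleDeg1Liftˣ) z = z + 1

/-- With `u p + v q = 1`, take `S = g^u * turn^v`. Its translation number is `u p / q + v = 1 / q >
0`, so it moves every point to the right. Moreover `S^p = g * Φ^(-v)` and `S^q = turn * Φ^u` with `Φ
= returnLift g p q`, and powers of `Φ` act trivially on fixed points of `Φ`. -/
lemma exists_isSuccessor {g : CircleDeg1Liftˣ} {p q : ℕ} (hq : 0 < q) (hpq : p.Coprime q)
    (hg : CircleDeg1Lift.translationNumber g = p / q) : ∃ S, IsSuccessor g S p q := by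
  have hcop : IsCoprime (p : ℤ) (q : ℤ) := Nat.isCoprime_iff_coprime.2 hpq
  obtain ⟨u, v, huv⟩ := id hcop
  have hq' : (0 : ℝ) < q := by exact_mod_cast hq
  have hgt : ∀ m n : ℤ, Commute (g ^ m) (turn ^ n) := fun m n =>
    ((commute_turn g).zpow_left m).zpow_right n
  have hS : ∀ n : ℤ, (g ^ u * turn ^ v) ^ n = g ^ (u * n) * turn ^ (v * n) := fun n => by
    rw [(hgt u v).mul_zpow, zpow_mul, zpow_mul]
  have hΦ : ∀ n : ℤ, returnLift g p q ^ n = g ^ (q * n) * turn ^ (-p * n) := fun n => by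
    rw [returnLift, (hgt _ _).mul_zpow, zpow_mul, zpow_mul]
  refine ⟨g ^ u * turn ^ v, hq, hcop, ?_, ?_, ?_, ?_⟩
  · exact ((Commute.refl g).zpow_left u).mul_left ((commute_turn g).symm.zpow_left v)
  · intro x
    have hτ : CircleDeg1Lift.translationNumber (g ^ u * turn ^ v : CircleDeg1Liftˣ) = 1 / q := by
      have hc : Commute ((g ^ u : CircleDeg1Liftˣ) : CircleDeg1Lift)
          ((turn ^ v : CircleDeg1Liftˣ) : CircleDeg1Lift) := congrArg Units.val (hgt u v).eq
      rw [Units.val_mul, CircleDeg1Lift.translationNumber_mul_of_commute hc,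
        CircleDeg1Lift.translationNumber_zpow, CircleDeg1Lift.translationNumber_zpow, hg, turn,
        CircleDeg1Lift.translationNumber_translate]
      have : (u : ℝ) * p + v * q = 1 := by exact_mod_cast huv
      field_simp
      linarith
    have := CircleDeg1Lift.lt_map_of_int_lt_translationNumber
      (g ^ u * turn ^ v : CircleDeg1Liftˣ) (n := 0) (by rw [hτ]; simpa using hq') x
    simpa using this
  · intro z hz
    have h1 : (g ^ u * turn ^ v) ^ (p : ℤ) = g * returnLift g p q ^ (-v) := by
      rw [hS, hΦ, ← mul_assoc, ← zpow_one_add]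
      congr 2
      · linear_combination huv
      · ring
    rw [h1, unit_mul_apply, zpow_apply_eq_self hz]
  · intro z hz
    have h1 : (g ^ u * turn ^ v) ^ (q : ℤ) = turn ^ (1 : ℤ) * returnLift g p q ^ u := by
      rw [hS, hΦ, ← mul_assoc, ((hgt _ _).symm : Commute (turn ^ (1 : ℤ)) (g ^ (q * u))).eq,
        mul_assoc, ← zpow_add]
      congr 2
      · ring
      · linear_combination huv
    rw [h1, unit_mul_apply, zpow_apply_eq_self hz, turn_zpow_apply]
    simp

namespace IsSuccessor

variable {g S : CircleDeg1Liftˣ} {p q : ℕ}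

lemma commute_returnLift (h : IsSuccessor g S p q) : Commute S (returnLift g p q) :=
  (h.commute.zpow_right _).mul_right ((commute_turn S).zpow_right _)

lemma returnLift_zpow_apply (h : IsSuccessor g S p q) (i : ℤ) (x : ℝ) :
    returnLift g p q ((S ^ i : CircleDeg1Liftˣ) x) =
      (S ^ i : CircleDeg1Liftˣ) (returnLift g p q x) := by
  rw [← unit_mul_apply, ← unit_mul_apply, (h.commute_returnLift.zpow_left i).eq]

lemma zpow_mem (h : IsSuccessor g S p q) (i : ℤ) {z : ℝ} (hz : returnLift g p q z = z) :
    returnLift g p q ((S ^ i : CircleDeg1Liftˣ) z) = (S ^ i : CircleDeg1Liftˣ) z := by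
  rw [h.returnLift_zpow_apply, hz]

lemma mem_of_zpow_mem (h : IsSuccessor g S p q) {i : ℤ} {z : ℝ}
    (hz : returnLift g p q ((S ^ i : CircleDeg1Liftˣ) z) = (S ^ i : CircleDeg1Liftˣ) z) :
    returnLift g p q z = z :=
  (strictMono_unit (S ^ i)).injective (by rw [← h.returnLift_zpow_apply, hz])

lemma zpow_add_apply (i j : ℤ) (x : ℝ) :
    (S ^ (i + j) : CircleDeg1Liftˣ) x =
      (S ^ i : CircleDeg1Liftˣ) ((S ^ j : CircleDeg1Liftˣ) x) := by
  rw [zpow_add, unit_mul_apply]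

lemma zpow_add_one_apply (i : ℤ) (x : ℝ) :
    (S ^ (i + 1) : CircleDeg1Liftˣ) x = (S ^ i : CircleDeg1Liftˣ) (S x) := by
  rw [zpow_add_apply, zpow_one]

lemma strictMono_zpow (h : IsSuccessor g S p q) (x : ℝ) :
    StrictMono fun i : ℤ => (S ^ i : CircleDeg1Liftˣ) x :=
  strictMono_int_of_lt_succ fun i => by
    rw [zpow_add_one_apply]
    exact strictMono_unit _ (h.lt x)

lemma g_zpow_apply (h : IsSuccessor g S p q) (n : ℤ) {z : ℝ} (hz : returnLift g p q z = z) :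
    (g ^ n : CircleDeg1Liftˣ) z = (S ^ (p * n) : CircleDeg1Liftˣ) z := by
  rw [zpow_mul]
  refine zpow_apply_eq_of_forall_apply_eq (Z := {z | returnLift g p q z = z}) (fun m w hw => ?_)
    h.pow_left n hz
  rw [← zpow_mul]
  exact h.zpow_mem _ hw

lemma zpow_mul_apply (h : IsSuccessor g S p q) (m : ℤ) {z : ℝ} (hz : returnLift g p q z = z) :
    (S ^ (q * m) : CircleDeg1Liftˣ) z = z + m := by
  rw [zpow_mul, ← turn_zpow_apply]
  refine zpow_apply_eq_of_forall_apply_eq (Z := {z | returnLift g p q z = z}) (fun m w hw => ?_)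
    (fun w hw => ?_) m hz
  · show returnLift g p q _ = _
    rw [turn_zpow_apply, CircleDeg1Lift.map_add_int, hw]
  · rw [h.pow_right w hw, ← zpow_one turn, turn_zpow_apply, Int.cast_one]

lemma zpow_add_mul_apply (h : IsSuccessor g S p q) (i m : ℤ) {z : ℝ}
    (hz : returnLift g p q z = z) :
    (S ^ (i + q * m) : CircleDeg1Liftˣ) z = (S ^ i : CircleDeg1Liftˣ) z + m := by
  rw [zpow_add_apply, h.zpow_mul_apply m hz, CircleDeg1Lift.map_add_int]

lemma isCyclic (h : IsSuccessor g S p q) {z : ℝ} (hz : returnLift g p q z = z) :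
    IsCyclic q fun i => (S ^ i : CircleDeg1Liftˣ) z := fun i => by
  have := h.zpow_add_mul_apply i 1 hz
  rwa [mul_one, Int.cast_one] at this

/-- The points `S ^ i z` increase strictly, and `S ^ (q m) z = z + m` makes them unbounded in both
directions, so they tile the line. -/
lemma exists_zpow_mem_Ico (h : IsSuccessor g S p q) {z : ℝ} (hz : returnLift g p q z = z)
    (t : ℝ) : ∃ i : ℤ,
      t ∈ Ico ((S ^ i : CircleDeg1Liftˣ) z) ((S ^ (i + 1) : CircleDeg1Liftˣ) z) := by
  obtain ⟨i, hi, hmax⟩ := Int.exists_greatest_of_bdd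
    (P := fun i : ℤ => (S ^ i : CircleDeg1Liftˣ) z ≤ t) ⟨q * (⌊t - z⌋ + 1), fun i hi => by
      by_contra! hcon
      have h1 := (h.strictMono_zpow z hcon).trans_le hi
      simp only [h.zpow_mul_apply _ hz] at h1
      push_cast at h1
      linarith [Int.lt_floor_add_one (t - z)]⟩ ⟨q * ⌊t - z⌋, by
      rw [h.zpow_mul_apply _ hz]
      linarith [Int.floor_le (t - z)]⟩
  refine ⟨i, hi, ?_⟩
  by_contra! hcon
  have := hmax _ hcon
  omega

lemma apply_le_add_one (h : IsSuccessor g S p q) {z : ℝ} (hz : returnLift g p q z = z) :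
    S z ≤ z + 1 := by
  have h1 := (h.strictMono_zpow z).monotone (show (1 : ℤ) ≤ q by exact_mod_cast h.pos)
  have h2 := h.zpow_mul_apply 1 hz
  rw [mul_one, Int.cast_one] at h2
  simp only [h2, zpow_one] at h1
  exact h1

/-! ### Concavity of the iterates -/

/-- For `0 < j < q`, the map `g^j` takes `[z, S z]` to `[S^r z, S^(r+1) z] + m`, where `p j = r + q
m` and `0 < r < q` by coprimality. This lies in `[S z, z + 1] + m`, hence between consecutive break
points, as `z ≤ c < S z`. -/
lemma mapsTo_pow (h : IsSuccessor g S p q) {c z : ℝ} (hz : returnLift g p q z = z) (hzc : z ≤ c)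
    (hcz : c < S z) {j : ℕ} (hj : j < q) :
    ∃ m : ℤ, MapsTo (g ^ j : CircleDeg1Liftˣ) (Icc c (S z)) (Icc (c + m) (c + m + 1)) := by
  rcases Nat.eq_zero_or_pos j with rfl | hj0
  · refine ⟨0, fun x hx => ?_⟩
    have := h.apply_le_add_one hz
    simp only [pow_zero, Units.val_one, CircleDeg1Lift.coe_one, id, Int.cast_zero, add_zero]
    exact ⟨hx.1, by linarith [hx.2]⟩
  · have hq0 : (0 : ℤ) < q := by exact_mod_cast h.pos
    set r : ℤ := (p * j) % q with hr
    set m : ℤ := (p * j) / q with hm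
    have hrm : (p * j : ℤ) = r + q * m := (Int.emod_add_mul_ediv _ _).symm
    have hr0 : 0 ≤ r := Int.emod_nonneg _ hq0.ne'
    have hrq : r < q := Int.emod_lt_of_pos _ hq0
    have hr1 : 1 ≤ r := by
      by_contra! hcon
      have hr00 : r = 0 := by omega
      have hdvd : (q : ℤ) ∣ p * j := Int.dvd_of_emod_eq_zero hr00
      have := h.coprime.symm.dvd_of_dvd_mul_left hdvd
      have := Int.le_of_dvd (by exact_mod_cast hj0) this
      omega
    refine ⟨m, fun x hx => ?_⟩
    have hmono := (strictMono_unit (g ^ j)).monotone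
    have h1 : (g ^ j : CircleDeg1Liftˣ) z = (S ^ r : CircleDeg1Liftˣ) z + m := by
      rw [← zpow_natCast, h.g_zpow_apply _ hz, hrm, h.zpow_add_mul_apply _ _ hz]
    have h2 : (g ^ j : CircleDeg1Liftˣ) (S z) = (S ^ (r + 1) : CircleDeg1Liftˣ) z + m := by
      have hSz := h.zpow_mem 1 hz
      rw [zpow_one] at hSz
      rw [← zpow_natCast, h.g_zpow_apply _ hSz, ← zpow_add_one_apply, hrm, add_right_comm,
        h.zpow_add_mul_apply _ _ hz]
    have h3 : S z ≤ (S ^ r : CircleDeg1Liftˣ) z := by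
      simpa using (h.strictMono_zpow z).monotone hr1
    have h4 : (S ^ (r + 1) : CircleDeg1Liftˣ) z ≤ z + 1 := by
      have e := h.zpow_mul_apply 1 hz
      rw [mul_one, Int.cast_one] at e
      rw [← e]
      exact (h.strictMono_zpow z).monotone (by omega)
    have h5 := hmono (hzc.trans hx.1)
    have h6 := hmono hx.2
    constructor <;> linarith

lemma _root_.ConcaveOn.comp_of_mapsTo {f g : ℝ → ℝ} {s t : Set ℝ} (hg : ConcaveOn ℝ t g)
    (hf : ConcaveOn ℝ s f) (hmono : Monotone g) (hmaps : MapsTo f s t) :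
    ConcaveOn ℝ s (g ∘ f) :=
  ⟨hf.1, fun _ hx _ hy _ _ ha hb hab => (hg.2 (hmaps hx) (hmaps hy) ha hb hab).trans
    (hmono (hf.2 hx hy ha hb hab))⟩

lemma _root_.ConcaveOn.comp_strictConcaveOn_of_mapsTo {f g : ℝ → ℝ} {s t : Set ℝ}
    (hg : ConcaveOn ℝ t g) (hf : StrictConcaveOn ℝ s f) (hmono : StrictMono g)
    (hmaps : MapsTo f s t) : StrictConcaveOn ℝ s (g ∘ f) :=
  ⟨hf.1, fun _ hx _ hy hne _ _ ha hb hab =>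
    (hg.2 (hmaps hx) (hmaps hy) ha.le hb.le hab).trans_lt (hmono (hf.2 hx hy hne ha hb hab))⟩

lemma concaveOn_pow (h : IsSuccessor g S p q) {c z : ℝ} (hconc : ConcaveOn ℝ (Icc c (c + 1)) g)
    (hz : returnLift g p q z = z) (hzc : z ≤ c) (hcz : c < S z) {j : ℕ} (hj : j ≤ q) :
    ConcaveOn ℝ (Icc c (S z)) (g ^ j : CircleDeg1Liftˣ) := by
  induction j with
  | zero =>
    simp only [pow_zero, Units.val_one, CircleDeg1Lift.coe_one]
    exact concaveOn_id (convex_Icc _ _)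
  | succ j ih =>
    obtain ⟨m, hm⟩ := h.mapsTo_pow hz hzc hcz (j := j) (by omega)
    rw [pow_succ', Units.val_mul, CircleDeg1Lift.coe_mul]
    exact (concaveOn_add_int hconc m).comp_of_mapsTo (ih (by omega)) (strictMono_unit g).monotone hm

lemma concaveOn_returnLift (h : IsSuccessor g S p q) {c z : ℝ}
    (hconc : ConcaveOn ℝ (Icc c (c + 1)) g)
    (hz : returnLift g p q z = z) (hzc : z ≤ c) (hcz : c < S z) :
    ConcaveOn ℝ (Icc c (S z)) fun x => returnLift g p q x - x := by
  have h1 := ((h.concaveOn_pow hconc hz hzc hcz le_rfl).add_const (-p : ℝ)).sub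
    (convexOn_id (convex_Icc c (S z)))
  refine h1.congr fun x _ => ?_
  rw [returnLift_apply]
  rfl

/-- The first application of `g` is already strictly concave on `[c, S z]`; the later ones are
strictly increasing and concave where needed, which preserves strictness. -/
lemma strictConcaveOn_returnLift (h : IsSuccessor g S p q) {c z : ℝ}
    (hconc : StrictConcaveOn ℝ (Icc c (c + 1)) g)
    (hz : returnLift g p q z = z) (hzc : z ≤ c) (hcz : c < S z) :
    StrictConcaveOn ℝ (Icc c (S z)) fun x => returnLift g p q x - x := by
  have hpow : ∀ j < q, StrictConcaveOn ℝ (Icc c (S z)) (g ^ (j + 1) : CircleDeg1Liftˣ) := by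
    intro j hj
    induction j with
    | zero =>
      rw [zero_add, pow_one]
      have := h.apply_le_add_one hz
      exact hconc.subset (Icc_subset_Icc_right (by linarith)) (convex_Icc _ _)
    | succ j ih =>
      obtain ⟨m, hm⟩ := h.mapsTo_pow hz hzc hcz (j := j + 1) hj
      rw [pow_succ', Units.val_mul, CircleDeg1Lift.coe_mul]
      exact (concaveOn_add_int hconc.concaveOn m).comp_strictConcaveOn_of_mapsTo (ih (by omega))
        (strictMono_unit g) hm
  have hq := hpow (q - 1) (Nat.sub_lt h.pos one_pos)
  rw [Nat.sub_add_cancel (Nat.one_le_iff_ne_zero.2 h.pos.ne')] at hq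
  have h1 := (hq.add_const (-p : ℝ)).sub_convexOn (convexOn_id (convex_Icc c (S z)))
  refine h1.congr fun x _ => ?_
  rw [returnLift_apply]
  rfl

end IsSuccessor

/-- Concavity makes `φ` nonnegative. At an interior zero the chord to either endpoint is flat, and
comparing slopes across this zero forbids positive values on either side. -/
lemma _root_.ConcaveOn.pos_or_eq_zero {φ : ℝ → ℝ} {a b : ℝ} (hφ : ConcaveOn ℝ (Icc a b) φ)
    (ha : φ a = 0) (hb : φ b = 0) :
    (∀ x ∈ Ioo a b, 0 < φ x) ∨ ∀ x ∈ Icc a b, φ x = 0 := by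
  rcases lt_or_ge b a with hba | hab
  · left
    intro x hx
    exact absurd (hx.1.trans hx.2) (not_lt.2 hba.le)
  have hnonneg : ∀ x ∈ Icc a b, 0 ≤ φ x := fun x hx => by
    have := hφ.min_le_of_mem_Icc (left_mem_Icc.2 hab) (right_mem_Icc.2 hab) hx
    rwa [ha, hb, min_self] at this
  by_cases hall : ∀ x ∈ Ioo a b, 0 < φ x
  · exact Or.inl hall
  right
  push Not at hall
  obtain ⟨x₀, hx₀, hle⟩ := hall
  have hx₀I := Ioo_subset_Icc_self hx₀
  have h0 : φ x₀ = 0 := le_antisymm hle (hnonneg x₀ hx₀I)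
  intro y hy
  refine le_antisymm ?_ (hnonneg y hy)
  rcases lt_trichotomy y x₀ with hlt | rfl | hlt
  · have := hφ.slope_anti_adjacent hy (right_mem_Icc.2 hab) hlt hx₀.2
    rw [h0, hb, sub_zero, zero_div, zero_sub, le_div_iff₀ (by linarith)] at this
    linarith
  · exact hle
  · have := hφ.slope_anti_adjacent (left_mem_Icc.2 hab) hy hx₀.1 hlt
    rw [h0, ha, sub_zero, sub_zero, zero_div, div_le_iff₀ (by linarith)] at this
    linarith

lemma _root_.Continuous.pos_or_neg_of_ne_zero {φ : ℝ → ℝ} (hφ : Continuous φ) {a b : ℝ}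
    (hne : ∀ x ∈ Ioo a b, φ x ≠ 0) : (∀ x ∈ Ioo a b, 0 < φ x) ∨ ∀ x ∈ Ioo a b, φ x < 0 := by
  by_contra! hcon
  obtain ⟨⟨x, hx, hx0⟩, y, hy, hy0⟩ := hcon
  obtain ⟨z, hz, hz0⟩ := isPreconnected_Ioo.intermediate_value hx hy hφ.continuousOn ⟨hx0, hy0⟩
  exact hne z hz hz0

/-! ### Fixed points of the return map in a fundamental domain -/

namespace IsSuccessor

variable {g S : CircleDeg1Liftˣ} {p q : ℕ}

/-- The position of the fixed points of the return map in a fundamental domain `[u, S u]`. -/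
lemma exists_fixed_pattern (h : IsSuccessor g S p q) {c : ℝ}
    (hconc : ConcaveOn ℝ (Icc c (c + 1)) g) (hne : ∃ z, returnLift g p q z = z) :
    ∃ u v : ℝ, returnLift g p q u = u ∧ returnLift g p q v = v ∧ u ≤ v ∧ v ≤ S u ∧
      (∀ x ∈ Ioo v (S u), returnLift g p q x < x) ∧
      ((∀ x ∈ Ioo u v, x < returnLift g p q x) ∨
        (u < v ∧ (∀ x ∈ Icc u v, returnLift g p q x = x) ∧
          ¬StrictConcaveOn ℝ (Icc c (c + 1)) g)) := by
  set Φ := returnLift g p q with hΦ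
  have hcont : Continuous fun x => Φ x - x := (continuous_unit Φ).sub continuous_id
  have hS : ∀ x, Φ (S x) = S (Φ x) := fun x => by
    simpa using h.returnLift_zpow_apply 1 x
  have hSmem : ∀ x, Φ x = x → Φ (S x) = S x := fun x hx => by rw [hS, hx]
  have hclosed : IsClosed {z | Φ z = z} := isClosed_eq (continuous_unit Φ) continuous_id
  -- A strictly concave `Φ - id` cannot vanish at two points and at their midpoint.
  have hnot : ∀ u v z, u < v → (∀ x ∈ Icc u v, Φ x = x) → Φ z = z → z ≤ c → c < S z → c ≤ u →
      v ≤ S z → ¬StrictConcaveOn ℝ (Icc c (c + 1)) g := by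
    intro u v z huv hfix hz hzc hcz hcu hvz hs
    have h1 := (h.strictConcaveOn_returnLift hs hz hzc hcz).2 (x := u) (y := v)
      ⟨hcu, huv.le.trans hvz⟩ ⟨hcu.trans huv.le, hvz⟩ huv.ne one_half_pos one_half_pos
      (add_halves 1)
    simp only [smul_eq_mul, ← hΦ, hfix u ⟨le_rfl, huv.le⟩, hfix v ⟨huv.le, le_rfl⟩] at h1
    rw [hfix _ ⟨by linarith, by linarith⟩] at h1
    simp at h1
  by_cases hc : Φ c = c
  · have hconc' := h.concaveOn_returnLift hconc hc le_rfl (h.lt c)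
    refine ⟨c, S c, hc, hSmem c hc, (h.lt c).le, le_rfl, by simp, ?_⟩
    rcases hconc'.pos_or_eq_zero (sub_eq_zero.2 hc) (sub_eq_zero.2 (hSmem c hc)) with h1 | h1
    · exact Or.inl fun x hx => sub_pos.1 (h1 x hx)
    · have h2 : ∀ x ∈ Icc c (S c), Φ x = x := fun x hx => sub_eq_zero.1 (h1 x hx)
      exact Or.inr ⟨h.lt c, h2, hnot c (S c) c (h.lt c) h2 hc le_rfl (h.lt c) le_rfl le_rfl⟩
  · obtain ⟨z₀, hz₀⟩ := hne
    obtain ⟨i, hi1, hi2⟩ := h.exists_zpow_mem_Ico hz₀ c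
    have hbdd1 : BddAbove ({z | Φ z = z} ∩ Iic c) := ⟨c, fun z hz => hz.2⟩
    have hbdd2 : BddBelow ({z | Φ z = z} ∩ Ici c) := ⟨c, fun z hz => hz.2⟩
    obtain ⟨hz1, hz1c⟩ := (hclosed.inter isClosed_Iic).csSup_mem ⟨_, h.zpow_mem i hz₀, hi1⟩ hbdd1
    obtain ⟨hz2, hz2c⟩ :=
      (hclosed.inter isClosed_Ici).csInf_mem ⟨_, h.zpow_mem (i + 1) hz₀, hi2.le⟩ hbdd2
    -- `z₁ < c < z₂` are the fixed points adjacent to the break point. On the gap between them `Φ -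
    -- id` has a constant sign, and concavity is available on `[c, S z₁]`.
    set z₁ := sSup ({z | Φ z = z} ∩ Iic c) with hz₁
    set z₂ := sInf ({z | Φ z = z} ∩ Ici c) with hz₂
    have hz1 : Φ z₁ = z₁ := hz1
    have hz2 : Φ z₂ = z₂ := hz2
    have hlt1 : z₁ < c := lt_of_le_of_ne hz1c fun e => hc (e ▸ hz1)
    have hlt2 : c < z₂ := lt_of_le_of_ne hz2c fun e => hc (e ▸ hz2)
    have hcS : c < S z₁ := by
      by_contra! hcon
      exact absurd (le_csSup hbdd1 ⟨hSmem _ hz1, hcon⟩) (not_le.2 (h.lt z₁))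
    have hle : z₂ ≤ S z₁ := csInf_le hbdd2 ⟨hSmem _ hz1, hcS.le⟩
    have hgap : ∀ x ∈ Ioo z₁ z₂, Φ x - x ≠ 0 := by
      intro x hx h0
      rcases le_total x c with hxc | hxc
      · exact absurd (le_csSup hbdd1 ⟨sub_eq_zero.1 h0, hxc⟩) (not_le.2 hx.1)
      · exact absurd (csInf_le hbdd2 ⟨sub_eq_zero.1 h0, hxc⟩) (not_le.2 hx.2)
    have hshift : ∀ x ∈ Ioo (S z₁) (S z₂), ∃ y ∈ Ioo z₁ z₂, S y = x := fun x hx => by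
      refine ⟨(S⁻¹ : CircleDeg1Liftˣ) x, ?_, CircleDeg1Lift.units_apply_inv_apply S x⟩
      have e := CircleDeg1Lift.units_apply_inv_apply S x
      constructor
      · rw [← (strictMono_unit S).lt_iff_lt, e]; exact hx.1
      · rw [← (strictMono_unit S).lt_iff_lt, e]; exact hx.2
    have hneg : (∀ x ∈ Ioo z₁ z₂, Φ x - x < 0) → ∀ x ∈ Ioo (S z₁) (S z₂), Φ x < x := by
      intro H x hx
      obtain ⟨y, hy, rfl⟩ := hshift x hx
      rw [hS]
      exact strictMono_unit S (sub_neg.1 (H y hy))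
    have hconc' := h.concaveOn_returnLift hconc hz1 hz1c hcS
    -- If `z₂ = S z₁`, the gap is a whole fundamental domain, there is a single periodic orbit, and
    -- both signs are possible: `v = S u` for the positive one, `v = u` for the negative one.
    rcases hle.eq_or_lt with heq | hlt
    · rcases hcont.pos_or_neg_of_ne_zero hgap with H | H
      · refine ⟨z₂, S z₂, hz2, hSmem _ hz2, (h.lt _).le, le_rfl, by simp, Or.inl ?_⟩
        intro x hx
        nth_rewrite 1 [heq] at hx
        obtain ⟨y, hy, rfl⟩ := hshift x hx
        rw [hS]
        exact strictMono_unit S (sub_pos.1 (H y hy))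
      · refine ⟨z₂, z₂, hz2, hz2, le_rfl, (h.lt _).le, ?_, Or.inl (by simp)⟩
        have := hneg H
        rwa [← heq] at this
    · have hH : ∀ x ∈ Ioo z₁ z₂, Φ x - x < 0 := by
        -- A concave function that is positive at `c` and zero at `z₂ > c` is negative beyond `z₂`,
        -- but it vanishes at `S z₁`.
        refine (hcont.pos_or_neg_of_ne_zero hgap).resolve_left fun H => ?_
        have h1 := hconc'.slope_anti_adjacent (x := c) (y := z₂) (z := S z₁) ⟨le_rfl, hcS.le⟩
          ⟨hcS.le, le_rfl⟩ hlt2 hlt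
        simp only [← hΦ, hSmem _ hz1, hz2, sub_self, zero_div, zero_sub] at h1
        rw [le_div_iff₀ (by linarith)] at h1
        have := H c ⟨hlt1, hlt2⟩
        linarith
      refine ⟨z₂, S z₁, hz2, hSmem _ hz1, hle, ?_, hneg hH, ?_⟩
      · exact (strictMono_unit S).monotone (hlt1.trans hlt2).le
      · rcases (hconc'.subset (Icc_subset_Icc_left hz2c) (convex_Icc _ _)).pos_or_eq_zero
          (sub_eq_zero.2 hz2) (sub_eq_zero.2 (hSmem _ hz1)) with h1 | h1
        · exact Or.inl fun x hx => sub_pos.1 (h1 x hx)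
        · have h2 : ∀ x ∈ Icc z₂ (S z₁), Φ x = x := fun x hx => sub_eq_zero.1 (h1 x hx)
          exact Or.inr ⟨hlt, h2, hnot _ _ z₁ hlt h2 hz1 hz1c hcS hz2c le_rfl⟩

end IsSuccessor

/-! ### Convergence to fixed points -/

/-- The iterates increase and stay below `b`; their limit is a fixed point, and `b` is the only one
left. -/
lemma tendsto_iterate_of_lt {F : ℝ → ℝ} (hF : Continuous F) (hmono : StrictMono F) {a b : ℝ}
    (ha : F a = a) (hb : F b = b) (hlt : ∀ x ∈ Ioo a b, x < F x) {x : ℝ} (hx : x ∈ Ioo a b) :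
    Tendsto (fun n : ℕ => F^[n] x) atTop (𝓝 b) := by
  have hmaps : MapsTo F (Ioo a b) (Ioo a b) := fun y hy => by
    have h1 := hmono hy.1
    have h2 := hmono hy.2
    rw [ha] at h1
    rw [hb] at h2
    exact ⟨h1, h2⟩
  have hmem : ∀ n, F^[n] x ∈ Ioo a b := fun n => hmaps.iterate n hx
  have hm : Monotone fun n : ℕ => F^[n] x := monotone_nat_of_le_succ fun n => by
    rw [Function.iterate_succ_apply']
    exact (hlt _ (hmem n)).le
  have hbdd : BddAbove (range fun n : ℕ => F^[n] x) := ⟨b, by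
    rintro _ ⟨n, rfl⟩
    exact (hmem n).2.le⟩
  have hlim := tendsto_atTop_ciSup hm hbdd
  have hfix : F (⨆ n : ℕ, F^[n] x) = ⨆ n : ℕ, F^[n] x :=
    isFixedPt_of_tendsto_iterate hlim hF.continuousAt
  have h1 : x ≤ ⨆ n : ℕ, F^[n] x := le_ciSup hbdd 0
  have h2 : ⨆ n : ℕ, F^[n] x ≤ b := ciSup_le fun n => (hmem n).2.le
  rcases h2.eq_or_lt with h3 | h3
  · rwa [h3] at hlim
  · exact absurd hfix (hlt _ ⟨hx.1.trans_le h1, h3⟩).ne'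

lemma tendsto_iterate_of_gt {F : ℝ → ℝ} (hF : Continuous F) (hmono : StrictMono F) {a b : ℝ}
    (ha : F a = a) (hb : F b = b) (hlt : ∀ x ∈ Ioo a b, F x < x) {x : ℝ} (hx : x ∈ Ioo a b) :
    Tendsto (fun n : ℕ => F^[n] x) atTop (𝓝 a) := by
  -- Conjugation with `y ↦ -y` reverses the order and reduces to the increasing case.
  have h1 : Tendsto (fun n : ℕ => (fun y => -F (-y))^[n] (-x)) atTop (𝓝 (-a)) := by
    refine tendsto_iterate_of_lt (hF.comp continuous_neg).neg ?_ (a := -b) (by simp [hb])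
      (by simp [ha]) ?_ ⟨neg_lt_neg hx.2, neg_lt_neg hx.1⟩
    · intro y z hyz
      exact neg_lt_neg (hmono (neg_lt_neg hyz))
    · intro y hy
      have := hlt (-y) ⟨by linarith [hy.2], by linarith [hy.1]⟩
      show y < -F (-y)
      linarith
  have h2 : ∀ n : ℕ, (fun y => -F (-y))^[n] (-x) = -F^[n] x := fun n => by
    induction n with
    | zero => rfl
    | succ n ih => rw [Function.iterate_succ_apply', Function.iterate_succ_apply', ih, neg_neg]
  simp only [h2] at h1
  simpa using h1.neg

/-- Along the times congruent to `r` modulo `q` the orbit converges to `f^[r] y`, and finitely many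
residue classes exhaust all times. -/
lemma forwardLimit_eq_range {f : UnitAddCircle ≃ₜ UnitAddCircle} {q : ℕ} (hq : 0 < q)
    {x y : UnitAddCircle} (h : Tendsto (fun n : ℕ => f^[n * q] x) atTop (𝓝 y)) :
    forwardLimit f x = range fun r : ℕ => f^[r] y := by
  have hr : ∀ r : ℕ, Tendsto (fun n : ℕ => f^[r + n * q] x) atTop (𝓝 (f^[r] y)) := fun r => by
    simp only [Function.iterate_add_apply]
    exact ((f.continuous.iterate r).tendsto y).comp h
  ext w
  rw [forwardLimit, mem_omegaLimit_singleton_iff_mapClusterPt]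
  constructor
  · intro hw
    -- An ultrafilter of times selects a single residue class modulo `q`, so the limit along it can
    -- be identified.
    obtain ⟨U, hU, hUw⟩ := mapClusterPt_iff_ultrafilter.1 hw
    obtain ⟨r, -, hUr⟩ := Ultrafilter.eq_pure_of_finite_mem (f := U.map (· % q)) (finite_Iio q)
      (Filter.univ_mem' (f := (U : Filter ℕ)) fun n => Nat.mod_lt n hq)
    have hmod : ∀ᶠ n in (U : Filter ℕ), n % q = r := by
      have : ({r} : Set ℕ) ∈ U.map (· % q) := by rw [hUr]; exact mem_singleton r
      exact this
    have hdiv : Tendsto (fun n : ℕ => n / q) U atTop :=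
      (Nat.tendsto_div_const_atTop hq.ne').mono_left hU
    have hlim := (hr r).comp hdiv
    refine ⟨r, tendsto_nhds_unique (hlim.congr' ?_) hUw⟩
    filter_upwards [hmod] with n hn
    show f^[r + n / q * q] x = f^[n] x
    rw [← hn, mul_comm, Nat.mod_add_div]
  · rintro ⟨r, rfl⟩
    have hφ : Tendsto (fun n : ℕ => r + n * q) atTop atTop :=
      tendsto_atTop_mono (fun n => (Nat.le_mul_of_pos_right n hq).trans (Nat.le_add_left _ r))
        tendsto_id
    exact MapClusterPt.of_comp hφ (hr r).mapClusterPt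

/-! ### Arcs and iterates on the circle -/

lemma openArc_map (g : CircleDeg1Liftˣ) {a b : ℝ} {x : UnitAddCircle} (hx : x ∈ openArc a b) :
    circleHomeo g x ∈ openArc (g a) (g b) := by
  obtain ⟨t, ht, rfl⟩ := hx
  exact ⟨g t, ⟨strictMono_unit g ht.1, strictMono_unit g ht.2⟩, rfl⟩

lemma closedArc_image (g : CircleDeg1Liftˣ) (a b : ℝ) :
    circleHomeo g '' closedArc a b = closedArc (g a) (g b) := by
  have h : (g : ℝ → ℝ) '' Icc a b = Icc (g a) (g b) := by
    rw [← CircleDeg1Lift.coe_toOrderIso, OrderIso.image_Icc]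
  rw [closedArc, closedArc, ← h, image_image, image_image]
  rfl

lemma circleHomeo_iterate (g : CircleDeg1Liftˣ) (n : ℕ) :
    (circleHomeo g)^[n] = circleHomeo (g ^ n) := by
  funext x
  obtain ⟨t, rfl⟩ := pt_surjective x
  rw [circleHomeo_iterate_pt, circleHomeo_pt]

lemma circleHomeo_symm (g : CircleDeg1Liftˣ) : (circleHomeo g).symm = circleHomeo g⁻¹ :=
  Homeomorph.ext fun x => by
    obtain ⟨t, rfl⟩ := pt_surjective x
    rfl

lemma circleHomeo_pow_eq_returnLift (g : CircleDeg1Liftˣ) (p q : ℕ) :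
    circleHomeo (g ^ q) = circleHomeo (returnLift g p q) :=
  Homeomorph.ext fun x => by
    obtain ⟨t, rfl⟩ := pt_surjective x
    rw [circleHomeo_pt, circleHomeo_pt, returnLift_apply]
    have := pt_add_int ((g ^ q : CircleDeg1Liftˣ) t) (-p)
    push_cast at this
    rw [← sub_eq_add_neg] at this
    exact this.symm

lemma circleHomeo_iterate_mul_pt (g : CircleDeg1Liftˣ) (p q n : ℕ) (t : ℝ) :
    (circleHomeo g)^[n * q] (pt t) = pt ((returnLift g p q)^[n] t) := by
  rw [mul_comm, Function.iterate_mul, circleHomeo_iterate, circleHomeo_pow_eq_returnLift g p,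
    circleHomeo_iterate_pt, Units.val_pow_eq_pow_val, CircleDeg1Lift.coe_pow]

lemma circleHomeo_symm_iterate_mul_pt (g : CircleDeg1Liftˣ) (p q n : ℕ) (t : ℝ) :
    (circleHomeo g).symm^[n * q] (pt t) =
      pt (((returnLift g p q)⁻¹ : CircleDeg1Liftˣ)^[n] t) := by
  rw [mul_comm, Function.iterate_mul, circleHomeo_symm, circleHomeo_iterate, inv_pow,
    ← circleHomeo_symm, circleHomeo_pow_eq_returnLift g p, circleHomeo_symm,
    circleHomeo_iterate_pt, Units.val_pow_eq_pow_val, CircleDeg1Lift.coe_pow]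

/-- A `q`-periodic family of sets, indexed by `ZMod q`. -/
def zmodFamily (q : ℕ) (A : ℤ → Set UnitAddCircle) (i : ZMod q) : Set UnitAddCircle :=
  A (i.cast : ℤ)

lemma zmodFamily_intCast {q : ℕ} {A : ℤ → Set UnitAddCircle} (hA : ∀ i, A (i + q) = A i) (i : ℤ) :
    zmodFamily q A (i : ZMod q) = A i := by
  rw [zmodFamily, ZMod.coe_intCast]
  have hper : Function.Periodic A (q : ℤ) := hA
  have h1 := hper.int_mul (i / q) (i % q)
  rw [Int.cast_id, Int.mul_comm, Int.emod_add_mul_ediv] at h1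
  exact h1.symm

lemma iUnion_zmodFamily {q : ℕ} {A : ℤ → Set UnitAddCircle} (hA : ∀ i, A (i + q) = A i) :
    ⋃ i, zmodFamily q A i = ⋃ i, A i := by
  rw [← (ZMod.intCast_surjective (n := q)).iUnion_comp]
  simp only [zmodFamily_intCast hA]

lemma closedArc_add_one (a b : ℝ) : closedArc (a + 1) (b + 1) = closedArc a b := by
  have h : (fun t : ℝ => t + 1) '' Icc a b = Icc (a + 1) (b + 1) := image_add_const_Icc 1 a b
  rw [closedArc, ← h, image_image]
  exact image_congr fun t _ => pt_add_one t

/-! ### Orbits and limit sets of the periodic points -/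

namespace IsSuccessor

variable {g S : CircleDeg1Liftˣ} {p q : ℕ}

lemma iterate_pt (h : IsSuccessor g S p q) {z : ℝ} (hz : returnLift g p q z = z) (i : ℤ) (n : ℕ) :
    (circleHomeo g)^[n] (pt ((S ^ i : CircleDeg1Liftˣ) z)) =
      pt ((S ^ (i + p * n) : CircleDeg1Liftˣ) z) := by
  rw [circleHomeo_iterate_pt, ← zpow_natCast, h.g_zpow_apply n (h.zpow_mem i hz), add_comm,
    zpow_add_apply]

lemma symm_iterate_pt (h : IsSuccessor g S p q) {z : ℝ} (hz : returnLift g p q z = z) (i : ℤ)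
    (n : ℕ) : (circleHomeo g).symm^[n] (pt ((S ^ i : CircleDeg1Liftˣ) z)) =
      pt ((S ^ (i + -p * n) : CircleDeg1Liftˣ) z) := by
  rw [circleHomeo_symm_iterate_pt, inv_pow, ← zpow_natCast, ← zpow_neg,
    h.g_zpow_apply _ (h.zpow_mem i hz), add_comm, zpow_add_apply, mul_neg, neg_mul]

/-- Steps of size `r` reach every residue class modulo `q`, and `S ^ (q m)` acts on `z` as an
integer translation, invisible on the circle. With `r = p` and `r = -p` this describes forward and
backward orbits. -/
lemma range_pt_eq (h : IsSuccessor g S p q) {z : ℝ} (hz : returnLift g p q z = z) {r : ℤ}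
    (hr : IsCoprime r (q : ℤ)) (i : ℤ) :
    (range fun n : ℕ => pt ((S ^ (i + r * n) : CircleDeg1Liftˣ) z)) =
      range fun j : ℤ => pt ((S ^ j : CircleDeg1Liftˣ) z) := by
  refine Subset.antisymm (by rintro _ ⟨n, rfl⟩; exact ⟨_, rfl⟩) ?_
  rintro _ ⟨j, rfl⟩
  obtain ⟨u, v, huv⟩ := hr
  have hq0 : (0 : ℤ) < q := by exact_mod_cast h.pos
  have h0 := Int.emod_nonneg ((j - i) * u) hq0.ne'
  have h1 := Int.emod_add_mul_ediv ((j - i) * u) q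
  -- Here `u` is the inverse of `r` modulo `q`; the reduction modulo `q` makes the number of steps
  -- nonnegative.
  refine ⟨(((j - i) * u) % q).toNat, ?_⟩
  have h2 : i + r * ((((j - i) * u) % q).toNat : ℤ) =
      j + q * (-(r * ((j - i) * u / q)) - v * (j - i)) := by
    rw [Int.toNat_of_nonneg h0]
    linear_combination r * h1 + (j - i) * huv
  simp only [h2]
  rw [h.zpow_add_mul_apply _ _ hz, pt_add_int]

lemma range_iterate_pt (h : IsSuccessor g S p q) {z : ℝ} (hz : returnLift g p q z = z) (i : ℤ) :
    (range fun n : ℕ => (circleHomeo g)^[n] (pt ((S ^ i : CircleDeg1Liftˣ) z))) =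
      range fun j : ℤ => pt ((S ^ j : CircleDeg1Liftˣ) z) := by
  simp only [h.iterate_pt hz]
  exact h.range_pt_eq hz h.coprime i

lemma range_symm_iterate_pt (h : IsSuccessor g S p q) {z : ℝ} (hz : returnLift g p q z = z)
    (i : ℤ) :
    (range fun n : ℕ => (circleHomeo g).symm^[n] (pt ((S ^ i : CircleDeg1Liftˣ) z))) =
      range fun j : ℤ => pt ((S ^ j : CircleDeg1Liftˣ) z) := by
  simp only [h.symm_iterate_pt hz]
  exact h.range_pt_eq hz h.coprime.neg_left i

lemma forwardLimit_eq (h : IsSuccessor g S p q) {z : ℝ} (hz : returnLift g p q z = z) {i : ℤ}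
    {x : UnitAddCircle} (hx : Tendsto (fun n : ℕ => (circleHomeo g)^[n * q] x) atTop
      (𝓝 (pt ((S ^ i : CircleDeg1Liftˣ) z)))) :
    forwardLimit (circleHomeo g) x = range fun j : ℤ => pt ((S ^ j : CircleDeg1Liftˣ) z) := by
  rw [forwardLimit_eq_range h.pos hx, h.range_iterate_pt hz]

lemma backwardLimit_eq (h : IsSuccessor g S p q) {z : ℝ} (hz : returnLift g p q z = z) {i : ℤ}
    {x : UnitAddCircle} (hx : Tendsto (fun n : ℕ => (circleHomeo g).symm^[n * q] x) atTop
      (𝓝 (pt ((S ^ i : CircleDeg1Liftˣ) z)))) :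
    backwardLimit (circleHomeo g) x = range fun j : ℤ => pt ((S ^ j : CircleDeg1Liftˣ) z) := by
  rw [backwardLimit, forwardLimit_eq_range h.pos hx, h.range_symm_iterate_pt hz]

lemma tendsto_iterate_of_fixed {z : ℝ} (hz : returnLift g p q z = z) :
    Tendsto (fun n : ℕ => (circleHomeo g)^[n * q] (pt z)) atTop (𝓝 (pt z)) := by
  have : ∀ n : ℕ, (circleHomeo g)^[n * q] (pt z) = pt z := fun n => by
    rw [circleHomeo_iterate_mul_pt g p, Function.iterate_fixed hz]
  simp only [this]
  exact tendsto_const_nhds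

lemma inv_fixed {Φ : CircleDeg1Liftˣ} {z : ℝ} (hz : Φ z = z) : (Φ⁻¹ : CircleDeg1Liftˣ) z = z := by
  conv_lhs => rw [← hz]
  exact CircleDeg1Lift.units_inv_apply_apply Φ z

lemma tendsto_symm_iterate_of_fixed {z : ℝ} (hz : returnLift g p q z = z) :
    Tendsto (fun n : ℕ => (circleHomeo g).symm^[n * q] (pt z)) atTop (𝓝 (pt z)) := by
  have : ∀ n : ℕ, (circleHomeo g).symm^[n * q] (pt z) = pt z := fun n => by
    rw [circleHomeo_symm_iterate_mul_pt g p, Function.iterate_fixed (inv_fixed hz)]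
  simp only [this]
  exact tendsto_const_nhds

lemma exists_zpow_eq (S : CircleDeg1Liftˣ) (i : ℤ) {a b x : ℝ}
    (hx : x ∈ Ioo ((S ^ i : CircleDeg1Liftˣ) a) ((S ^ i : CircleDeg1Liftˣ) b)) :
    ∃ y ∈ Ioo a b, (S ^ i : CircleDeg1Liftˣ) y = x := by
  have e := CircleDeg1Lift.units_apply_inv_apply (S ^ i) x
  refine ⟨((S ^ i)⁻¹ : CircleDeg1Liftˣ) x, ⟨?_, ?_⟩, e⟩
  · rw [← (strictMono_unit (S ^ i)).lt_iff_lt, e]; exact hx.1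
  · rw [← (strictMono_unit (S ^ i)).lt_iff_lt, e]; exact hx.2

lemma iterate_mem_openArc (h : IsSuccessor g S p q) {a b : ℝ} (ha : returnLift g p q a = a)
    (hb : returnLift g p q b = b) (i : ℤ) {x : UnitAddCircle}
    (hx : x ∈ openArc ((S ^ i : CircleDeg1Liftˣ) a) ((S ^ i : CircleDeg1Liftˣ) b)) (n : ℕ) :
    (circleHomeo g)^[n] x ∈ openArc ((S ^ (i + p * n) : CircleDeg1Liftˣ) a)
      ((S ^ (i + p * n) : CircleDeg1Liftˣ) b) := by
  have h1 := openArc_map (g ^ n) hx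
  rw [← circleHomeo_iterate, ← zpow_natCast, h.g_zpow_apply n (h.zpow_mem i ha),
    h.g_zpow_apply n (h.zpow_mem i hb), ← zpow_add_apply, ← zpow_add_apply] at h1
  rwa [add_comm]

lemma arcDynamics_of_lt (h : IsSuccessor g S p q) {a b : ℝ} (ha : returnLift g p q a = a)
    (hb : returnLift g p q b = b) (hlt : ∀ x ∈ Ioo a b, x < returnLift g p q x) :
    ArcDynamics (circleHomeo g) p q (fun i => (S ^ i : CircleDeg1Liftˣ) a)
      (fun i => (S ^ i : CircleDeg1Liftˣ) b) (fun i => (S ^ i : CircleDeg1Liftˣ) b)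
      (fun i => (S ^ i : CircleDeg1Liftˣ) a) := by
  intro i x hx
  refine ⟨h.iterate_mem_openArc ha hb i hx, ?_⟩
  obtain ⟨t, ht, rfl⟩ := hx
  have hlt' : ∀ y ∈ Ioo ((S ^ i : CircleDeg1Liftˣ) a) ((S ^ i : CircleDeg1Liftˣ) b),
      y < returnLift g p q y := fun y hy => by
    obtain ⟨w, hw, rfl⟩ := exists_zpow_eq S i hy
    rw [h.returnLift_zpow_apply]
    exact strictMono_unit _ (hlt w hw)
  have ha' := h.zpow_mem i ha
  have hb' := h.zpow_mem i hb
  constructor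
  · simp only [circleHomeo_iterate_mul_pt g p]
    exact (continuous_pt.tendsto _).comp
      (tendsto_iterate_of_lt (continuous_unit _) (strictMono_unit _) ha' hb' hlt' ht)
  · simp only [circleHomeo_symm_iterate_mul_pt g p]
    refine (continuous_pt.tendsto _).comp (tendsto_iterate_of_gt (continuous_unit _)
      (strictMono_unit _) (inv_fixed ha') (inv_fixed hb') (fun y hy => ?_) ht)
    rw [← (strictMono_unit (returnLift g p q)).lt_iff_lt, CircleDeg1Lift.units_apply_inv_apply]
    exact hlt' y hy

lemma arcDynamics_of_gt (h : IsSuccessor g S p q) {a b : ℝ} (ha : returnLift g p q a = a)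
    (hb : returnLift g p q b = b) (hlt : ∀ x ∈ Ioo a b, returnLift g p q x < x) :
    ArcDynamics (circleHomeo g) p q (fun i => (S ^ i : CircleDeg1Liftˣ) a)
      (fun i => (S ^ i : CircleDeg1Liftˣ) b) (fun i => (S ^ i : CircleDeg1Liftˣ) a)
      (fun i => (S ^ i : CircleDeg1Liftˣ) b) := by
  intro i x hx
  refine ⟨h.iterate_mem_openArc ha hb i hx, ?_⟩
  obtain ⟨t, ht, rfl⟩ := hx
  have hlt' : ∀ y ∈ Ioo ((S ^ i : CircleDeg1Liftˣ) a) ((S ^ i : CircleDeg1Liftˣ) b),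
      returnLift g p q y < y := fun y hy => by
    obtain ⟨w, hw, rfl⟩ := exists_zpow_eq S i hy
    rw [h.returnLift_zpow_apply]
    exact strictMono_unit _ (hlt w hw)
  have ha' := h.zpow_mem i ha
  have hb' := h.zpow_mem i hb
  constructor
  · simp only [circleHomeo_iterate_mul_pt g p]
    exact (continuous_pt.tendsto _).comp
      (tendsto_iterate_of_gt (continuous_unit _) (strictMono_unit _) ha' hb' hlt' ht)
  · simp only [circleHomeo_symm_iterate_mul_pt g p]
    refine (continuous_pt.tendsto _).comp (tendsto_iterate_of_lt (continuous_unit _)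
      (strictMono_unit _) (inv_fixed ha') (inv_fixed hb') (fun y hy => ?_) ht)
    rw [← (strictMono_unit (returnLift g p q)).lt_iff_lt, CircleDeg1Lift.units_apply_inv_apply]
    exact hlt' y hy

/-! ### Periodic points on the circle -/

/-- If `g^n t = t + m`, the translation number is `m / n = p / q`, so `n = q k` and `m = p k` by
coprimality. For monotone maps of degree one, `(g^q)^k t = t + k p` already implies `g^q t = t + p`.
-/
lemma isPeriodicPt_pt_iff (h : IsSuccessor g S p q)
    (hg : CircleDeg1Lift.translationNumber g = p / q) {n : ℕ} (hn : 0 < n) {t : ℝ} :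
    Function.IsPeriodicPt (circleHomeo g) n (pt t) ↔ returnLift g p q t = t ∧ q ∣ n := by
  rw [Function.IsPeriodicPt, Function.IsFixedPt, circleHomeo_iterate_pt, eq_comm, pt_eq_pt_iff]
  constructor
  · rintro ⟨m, hm⟩
    have hτ := CircleDeg1Lift.translationNumber_of_map_pow_eq_add_int (g : CircleDeg1Lift)
      (by rw [← Units.val_pow_eq_pow_val]; exact hm) hn
    have hq0 : (q : ℝ) ≠ 0 := by exact_mod_cast h.pos.ne'
    have hn0 : (n : ℝ) ≠ 0 := by exact_mod_cast hn.ne'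
    rw [hg, div_eq_div_iff hq0 hn0] at hτ
    have hτ' : (p : ℤ) * n = m * q := by exact_mod_cast hτ
    have hdvd : (q : ℤ) ∣ n := h.coprime.symm.dvd_of_dvd_mul_left ⟨m, by rw [hτ', mul_comm]⟩
    have hdvd' : q ∣ n := by exact_mod_cast hdvd
    refine ⟨?_, hdvd'⟩
    obtain ⟨k, rfl⟩ := hdvd'
    have hk : 0 < k := Nat.pos_of_mul_pos_left hn
    have hm' : m = p * k := by
      have hq0' : (q : ℤ) ≠ 0 := by exact_mod_cast h.pos.ne'
      refine mul_right_cancel₀ hq0' ?_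
      rw [← hτ']
      push_cast
      ring
    have hpow : (((g ^ q : CircleDeg1Liftˣ) : CircleDeg1Lift))^[k] t = t + k * (p : ℤ) := by
      rw [← CircleDeg1Lift.coe_pow, ← Units.val_pow_eq_pow_val, ← pow_mul, hm, hm']
      push_cast
      ring
    rw [CircleDeg1Lift.iterate_pos_eq_iff _ hk] at hpow
    rw [returnLift_apply, hpow]
    simp
  · rintro ⟨ht, k, rfl⟩
    refine ⟨p * k, ?_⟩
    rw [← zpow_natCast, h.g_zpow_apply _ ht,
      show (p : ℤ) * ((q * k : ℕ) : ℤ) = q * (p * k) by push_cast; ring, h.zpow_mul_apply _ ht]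

lemma minimalPeriod_pt (h : IsSuccessor g S p q)
    (hg : CircleDeg1Lift.translationNumber g = p / q) {t : ℝ} (ht : returnLift g p q t = t) :
    Function.minimalPeriod (circleHomeo g) (pt t) = q := by
  have h1 := (h.isPeriodicPt_pt_iff hg h.pos).2 ⟨ht, dvd_rfl⟩
  refine Nat.dvd_antisymm h1.minimalPeriod_dvd ?_
  exact ((h.isPeriodicPt_pt_iff hg (h1.minimalPeriod_pos h.pos)).1
    (Function.isPeriodicPt_minimalPeriod _ _)).2

lemma mem_periodicPts_pt_iff (h : IsSuccessor g S p q)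
    (hg : CircleDeg1Lift.translationNumber g = p / q) {t : ℝ} :
    pt t ∈ Function.periodicPts (circleHomeo g) ↔ returnLift g p q t = t := by
  constructor
  · rintro ⟨n, hn, hper⟩
    exact ((h.isPeriodicPt_pt_iff hg hn).1 hper).1
  · intro ht
    exact ⟨q, h.pos, (h.isPeriodicPt_pt_iff hg h.pos).2 ⟨ht, dvd_rfl⟩⟩

lemma closedArc_add (h : IsSuccessor g S p q) {a b : ℝ} (ha : returnLift g p q a = a)
    (hb : returnLift g p q b = b) (i : ℤ) :
    closedArc ((S ^ (i + q) : CircleDeg1Liftˣ) a) ((S ^ (i + q) : CircleDeg1Liftˣ) b) =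
      closedArc ((S ^ i : CircleDeg1Liftˣ) a) ((S ^ i : CircleDeg1Liftˣ) b) := by
  have ea : (S ^ (i + q) : CircleDeg1Liftˣ) a = (S ^ i : CircleDeg1Liftˣ) a + 1 := h.isCyclic ha i
  have eb : (S ^ (i + q) : CircleDeg1Liftˣ) b = (S ^ i : CircleDeg1Liftˣ) b + 1 := h.isCyclic hb i
  rw [ea, eb, closedArc_add_one]

lemma exists_zpow_eq_Icc (S : CircleDeg1Liftˣ) (i : ℤ) {a b x : ℝ}
    (hx : x ∈ Icc ((S ^ i : CircleDeg1Liftˣ) a) ((S ^ i : CircleDeg1Liftˣ) b)) :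
    ∃ y ∈ Icc a b, (S ^ i : CircleDeg1Liftˣ) y = x := by
  have e := CircleDeg1Lift.units_apply_inv_apply (S ^ i) x
  refine ⟨((S ^ i)⁻¹ : CircleDeg1Liftˣ) x, ⟨?_, ?_⟩, e⟩
  · rw [← (strictMono_unit (S ^ i)).le_iff_le, e]; exact hx.1
  · rw [← (strictMono_unit (S ^ i)).le_iff_le, e]; exact hx.2

/-- The arcs of periodic points. -/
def arcs (S : CircleDeg1Liftˣ) (q : ℕ) (a b : ℝ) : ZMod q → Set UnitAddCircle :=
  zmodFamily q fun i => closedArc ((S ^ i : CircleDeg1Liftˣ) a) ((S ^ i : CircleDeg1Liftˣ) b)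

lemma arcs_intCast (h : IsSuccessor g S p q) {a b : ℝ} (ha : returnLift g p q a = a)
    (hb : returnLift g p q b = b) (i : ℤ) :
    arcs S q a b i = closedArc ((S ^ i : CircleDeg1Liftˣ) a) ((S ^ i : CircleDeg1Liftˣ) b) :=
  zmodFamily_intCast (h.closedArc_add ha hb) i

lemma mem_iUnion_arcs_iff (h : IsSuccessor g S p q) {a b : ℝ} (ha : returnLift g p q a = a)
    (hb : returnLift g p q b = b) {x : UnitAddCircle} : x ∈ ⋃ i, arcs S q a b i ↔
      ∃ i : ℤ, x ∈ closedArc ((S ^ i : CircleDeg1Liftˣ) a) ((S ^ i : CircleDeg1Liftˣ) b) := by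
  rw [arcs, iUnion_zmodFamily (h.closedArc_add ha hb), mem_iUnion]

lemma arcs_image (h : IsSuccessor g S p q) {a b : ℝ} (ha : returnLift g p q a = a)
    (hb : returnLift g p q b = b) (i : ZMod q) (n : ℕ) :
    (circleHomeo g)^[n] '' arcs S q a b i = arcs S q a b (i + p * n) := by
  obtain ⟨i, rfl⟩ := ZMod.intCast_surjective i
  have h1 : ((i : ZMod q) + p * n) = ((i + p * n : ℤ) : ZMod q) := by push_cast; ring
  rw [h1, h.arcs_intCast ha hb, h.arcs_intCast ha hb, circleHomeo_iterate, closedArc_image,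
    ← zpow_natCast, h.g_zpow_apply n (h.zpow_mem i ha), h.g_zpow_apply n (h.zpow_mem i hb),
    ← zpow_add_apply, ← zpow_add_apply, add_comm]

lemma isPeriodicDecomposition (h : IsSuccessor g S p q)
    (hg : CircleDeg1Lift.translationNumber g = p / q) {a b a' b' : ℝ} (hab : a ≤ b)
    (hba : b ≤ S a) (hab' : a' ≤ b') (hba' : b' ≤ S a')
    (hZ : ∀ t ∈ Icc a b, returnLift g p q t = t) (hZ' : ∀ t ∈ Icc a' b', returnLift g p q t = t)
    (hall : ∀ t, returnLift g p q t = t → ∃ i : ℤ,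
      t ∈ Icc ((S ^ i : CircleDeg1Liftˣ) a) ((S ^ i : CircleDeg1Liftˣ) b) ∨
        t ∈ Icc ((S ^ i : CircleDeg1Liftˣ) a') ((S ^ i : CircleDeg1Liftˣ) b')) :
    IsPeriodicDecomposition (circleHomeo g) p q (arcs S q a b) (arcs S q a' b') := by
  have ha := hZ a ⟨le_rfl, hab⟩
  have hb := hZ b ⟨hab, le_rfl⟩
  have ha' := hZ' a' ⟨le_rfl, hab'⟩
  have hb' := hZ' b' ⟨hab', le_rfl⟩
  have harc : ∀ {a b : ℝ}, a ≤ b → b ≤ S a → returnLift g p q a = a → ∀ i : ZMod q,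
      ∃ u v : ℝ, u ≤ v ∧ v ≤ u + 1 ∧ arcs S q a b i = closedArc u v := fun {a b} hab hba ha i => by
    refine ⟨_, _, (strictMono_unit _).monotone hab, ?_, rfl⟩
    refine ((strictMono_unit _).monotone (hba.trans (h.apply_le_add_one ha))).trans ?_
    rw [CircleDeg1Lift.map_add_one]
  have hper : ∀ {a b : ℝ}, returnLift g p q a = a → returnLift g p q b = b →
      (∀ t ∈ Icc a b, returnLift g p q t = t) → ∀ x ∈ ⋃ i, arcs S q a b i,
      Function.minimalPeriod (circleHomeo g) x = q := fun {a b} ha hb hZ x hx => by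
    obtain ⟨i, t, ht, rfl⟩ := (h.mem_iUnion_arcs_iff ha hb).1 hx
    obtain ⟨y, hy, rfl⟩ := exists_zpow_eq_Icc S i ht
    exact h.minimalPeriod_pt hg (h.zpow_mem i (hZ y hy))
  refine ⟨harc hab hba ha, harc hab' hba' ha', ?_, h.arcs_image ha hb, h.arcs_image ha' hb', ?_⟩
  · rintro x (hx | hx)
    · exact hper ha' hb' hZ' x hx
    · exact hper ha hb hZ x hx
  · intro x hx hper
    obtain ⟨t, rfl⟩ := pt_surjective x
    obtain ⟨i, hi⟩ := hall t ((h.mem_periodicPts_pt_iff hg).1 hper)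
    refine hx ?_
    rcases hi with hi | hi
    · exact Or.inr ((h.mem_iUnion_arcs_iff ha hb).2 ⟨i, t, hi, rfl⟩)
    · exact Or.inl ((h.mem_iUnion_arcs_iff ha' hb').2 ⟨i, t, hi, rfl⟩)

end IsSuccessor

/-! ### The two cases of the rational dynamics -/

namespace IsSuccessor

variable {g S : CircleDeg1Liftˣ} {p q : ℕ}

lemma closedArc_self (a : ℝ) : closedArc a a = {pt a} := by
  rw [closedArc, Icc_self, image_singleton]

/-- Every fixed point of the return map is one of the points `S ^ i u`, `S ^ i v`, if there are
none strictly between them. -/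
lemma fixed_eq_or_eq (h : IsSuccessor g S p q) {u v : ℝ} (hu : returnLift g p q u = u)
    (hneg : ∀ x ∈ Ioo v (S u), returnLift g p q x < x)
    (hpos : ∀ x ∈ Ioo u v, x < returnLift g p q x) {t : ℝ} (ht : returnLift g p q t = t) :
    ∃ i : ℤ, t = (S ^ i : CircleDeg1Liftˣ) u ∨ t = (S ^ i : CircleDeg1Liftˣ) v := by
  obtain ⟨i, hi⟩ := h.exists_zpow_mem_Ico hu t
  refine ⟨i, ?_⟩
  rw [zpow_add_one_apply] at hi
  rcases hi.1.eq_or_lt with h1 | h1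
  · exact Or.inl h1.symm
  right
  by_contra hne
  rcases lt_or_gt_of_ne hne with h2 | h2
  · obtain ⟨y, hy, rfl⟩ := exists_zpow_eq S i ⟨h1, h2⟩
    exact (hpos y hy).ne' (h.mem_of_zpow_mem ht)
  · obtain ⟨y, hy, rfl⟩ := exists_zpow_eq S i ⟨h2, hi.2⟩
    exact (hneg y hy).ne (h.mem_of_zpow_mem ht)

lemma caseA (h : IsSuccessor g S p q) {u v : ℝ} (hu : returnLift g p q u = u)
    (hv : returnLift g p q v = v) (huv : u ≤ v) (hvu : v ≤ S u)
    (hneg : ∀ x ∈ Ioo v (S u), returnLift g p q x < x)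
    (hpos : ∀ x ∈ Ioo u v, x < returnLift g p q x) :
    CaseA (circleHomeo g) p q (arcs S q u u) (arcs S q v v) := by
  have hSu : returnLift g p q (S u) = S u := by
    have := h.zpow_mem 1 hu
    rwa [zpow_one] at this
  have dpos := h.arcDynamics_of_lt hu hv hpos
  have dneg := h.arcDynamics_of_gt hv hSu hneg
  -- The tiles `[S^i u, S^(i+1) u)` are split at `S^i v`; every point is thus periodic or in an arc
  -- with known dynamics.
  have key : ∀ t : ℝ, ∃ i : ℤ,
      t = (S ^ i : CircleDeg1Liftˣ) u ∨
      pt t ∈ openArc ((S ^ i : CircleDeg1Liftˣ) u) ((S ^ i : CircleDeg1Liftˣ) v) ∨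
      t = (S ^ i : CircleDeg1Liftˣ) v ∨
      pt t ∈ openArc ((S ^ i : CircleDeg1Liftˣ) v) ((S ^ i : CircleDeg1Liftˣ) (S u)) := by
    intro t
    obtain ⟨i, hi⟩ := h.exists_zpow_mem_Ico hu t
    rw [zpow_add_one_apply] at hi
    refine ⟨i, ?_⟩
    rcases hi.1.eq_or_lt with h1 | h1
    · exact Or.inl h1.symm
    rcases lt_trichotomy t ((S ^ i : CircleDeg1Liftˣ) v) with h2 | h2 | h2
    · exact Or.inr (Or.inl ⟨t, ⟨h1, h2⟩, rfl⟩)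
    · exact Or.inr (Or.inr (Or.inl h2))
    · exact Or.inr (Or.inr (Or.inr ⟨t, ⟨h2, hi.2⟩, rfl⟩))
  refine ⟨fun i => (S ^ i : CircleDeg1Liftˣ) u, fun i => (S ^ i : CircleDeg1Liftˣ) v,
    h.isCyclic hu, h.isCyclic hv, fun i => ⟨?_, ?_⟩, fun i => ⟨?_, ?_⟩,
    fun i n => ⟨h.iterate_pt hu i n, h.iterate_pt hv i n⟩, dpos, ?_, ?_, ?_⟩
  · rw [h.arcs_intCast hu hu, closedArc_self]
  · rw [h.arcs_intCast hv hv, closedArc_self]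
  · exact (strictMono_unit _).monotone huv
  · simp only [zpow_add_one_apply]
    exact (strictMono_unit _).monotone hvu
  · simp only [zpow_add_one_apply]
    exact dneg
  · intro x hx
    obtain ⟨t, rfl⟩ := pt_surjective x
    obtain ⟨i, rfl | ht | rfl | ht⟩ := key t
    · exact absurd ⟨i, rfl⟩ hx
    · exact h.forwardLimit_eq hv (dpos i _ ht).2.1
    · exact h.forwardLimit_eq hv (tendsto_iterate_of_fixed (h.zpow_mem i hv))
    · exact h.forwardLimit_eq hv (dneg i _ ht).2.1
  · intro x hx
    obtain ⟨t, rfl⟩ := pt_surjective x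
    obtain ⟨i, rfl | ht | rfl | ht⟩ := key t
    · exact h.backwardLimit_eq hu (tendsto_symm_iterate_of_fixed (h.zpow_mem i hu))
    · exact h.backwardLimit_eq hu (dpos i _ ht).2.2
    · exact absurd ⟨i, rfl⟩ hx
    · refine h.backwardLimit_eq hu (i := i + 1) ?_
      rw [zpow_add_one_apply]
      exact (dneg i _ ht).2.2

lemma caseB (h : IsSuccessor g S p q) (hg : CircleDeg1Lift.translationNumber g = p / q) {u v : ℝ}
    (huv : u < v) (hvu : v ≤ S u) (hneg : ∀ x ∈ Ioo v (S u), returnLift g p q x < x)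
    (hfix : ∀ x ∈ Icc u v, returnLift g p q x = x) :
    CaseB (circleHomeo g) p q (arcs S q u v) (arcs S q u v) := by
  have hu := hfix u ⟨le_rfl, huv.le⟩
  have hv := hfix v ⟨huv.le, le_rfl⟩
  have hSu : returnLift g p q (S u) = S u := by
    have := h.zpow_mem 1 hu
    rwa [zpow_one] at this
  have dneg := h.arcDynamics_of_gt hv hSu hneg
  have hlt : ∀ i : ℤ, (S ^ i : CircleDeg1Liftˣ) v < (S ^ (i + 1) : CircleDeg1Liftˣ) u ↔ v < S u :=
    fun i => by rw [zpow_add_one_apply, (strictMono_unit _).lt_iff_lt]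
  have key : ∀ t : ℝ, ∃ i : ℤ,
      t ∈ Icc ((S ^ i : CircleDeg1Liftˣ) u) ((S ^ i : CircleDeg1Liftˣ) v) ∨
      t ∈ Ioo ((S ^ i : CircleDeg1Liftˣ) v) ((S ^ i : CircleDeg1Liftˣ) (S u)) := by
    intro t
    obtain ⟨i, hi⟩ := h.exists_zpow_mem_Ico hu t
    rw [zpow_add_one_apply] at hi
    refine ⟨i, ?_⟩
    rcases le_or_gt t ((S ^ i : CircleDeg1Liftˣ) v) with h2 | h2
    · exact Or.inl ⟨hi.1, h2⟩
    · exact Or.inr ⟨h2, hi.2⟩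
  refine ⟨fun i => (S ^ i : CircleDeg1Liftˣ) u, fun i => (S ^ i : CircleDeg1Liftˣ) v,
    h.isCyclic hu, h.isCyclic hv, fun i => ⟨h.arcs_intCast hu hv i, h.arcs_intCast hu hv i⟩,
    fun i => ⟨strictMono_unit _ huv, ?_⟩, ?_, fun _ => ⟨?_, ?_⟩, ?_⟩
  · simp only [zpow_add_one_apply]
    exact (strictMono_unit _).monotone hvu
  · simp only [hlt, exists_const, forall_const]
  · simp only [zpow_add_one_apply]
    exact dneg
  · intro x hx
    obtain ⟨t, rfl⟩ := pt_surjective x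
    obtain ⟨i, ht | ht⟩ := key t
    · exact absurd ((h.mem_iUnion_arcs_iff hu hv).2 ⟨i, t, ht, rfl⟩) hx
    · have ht' : pt t ∈ openArc ((S ^ i : CircleDeg1Liftˣ) v) ((S ^ i : CircleDeg1Liftˣ) (S u)) :=
        ⟨t, ht, rfl⟩
      refine ⟨h.forwardLimit_eq hv (dneg i _ ht').2.1, h.backwardLimit_eq hu (i := i + 1) ?_⟩
      rw [zpow_add_one_apply]
      exact (dneg i _ ht').2.2
  · intro heq x
    obtain ⟨t, rfl⟩ := pt_surjective x
    rw [h.mem_periodicPts_pt_iff hg]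
    obtain ⟨i, ht | ht⟩ := key t
    · obtain ⟨y, hy, rfl⟩ := exists_zpow_eq_Icc S i ht
      exact h.zpow_mem i (hfix y hy)
    -- When the periodic arcs abut, the gap is empty.
    · have := heq i
      simp only [zpow_add_one_apply] at this
      exact absurd (ht.1.trans ht.2) (by rw [this]; exact lt_irrefl _)

end IsSuccessor

/-- The dynamics of a circle homeomorphism with rational rotation number which is concave outside
of one point. -/
lemma rational_dynamics {g : CircleDeg1Liftˣ} {c : ℝ} (hconc : ConcaveOn ℝ (Icc c (c + 1)) g)
    {p q : ℕ} (hq : 0 < q) (hpq : p.Coprime q)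
    (hg : CircleDeg1Lift.translationNumber g = p / q) :
    (∃ Pminus Pplus : ZMod q → Set UnitAddCircle,
      IsPeriodicDecomposition (circleHomeo g) p q Pminus Pplus ∧
      (CaseA (circleHomeo g) p q Pminus Pplus ∨ CaseB (circleHomeo g) p q Pminus Pplus)) ∧
    (StrictConcaveOn ℝ (Icc c (c + 1)) g →
      ∀ Pminus Pplus : ZMod q → Set UnitAddCircle,
        IsPeriodicDecomposition (circleHomeo g) p q Pminus Pplus →
        ¬CaseB (circleHomeo g) p q Pminus Pplus) := by
  obtain ⟨S, h⟩ := exists_isSuccessor hq hpq hg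
  have hne : ∃ z, returnLift g p q z = z := by
    have hg' : CircleDeg1Lift.translationNumber g = (p : ℤ) / q := by rw [hg]; simp
    obtain ⟨z, hz⟩ := (CircleDeg1Lift.translationNumber_eq_rat_iff (g : CircleDeg1Lift)
      (continuous_unit g) hq).1 hg'
    refine ⟨z, ?_⟩
    rw [returnLift_apply, Units.val_pow_eq_pow_val, hz]
    simp
  obtain ⟨u, v, hu, hv, huv, hvu, hneg, hcase⟩ := h.exists_fixed_pattern hconc hne
  constructor
  · rcases hcase with hpos | ⟨hlt, hfix, -⟩
    · refine ⟨_, _, h.isPeriodicDecomposition hg le_rfl (h.lt u).le le_rfl (h.lt v).le ?_ ?_ ?_,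
        Or.inl (h.caseA hu hv huv hvu hneg hpos)⟩
      · simpa using hu
      · simpa using hv
      · intro t ht
        obtain ⟨i, hi⟩ := h.fixed_eq_or_eq hu hneg hpos ht
        exact ⟨i, by simpa using hi⟩
    · refine ⟨_, _, h.isPeriodicDecomposition hg hlt.le hvu hlt.le hvu hfix hfix ?_,
        Or.inr (h.caseB hg hlt hvu hneg hfix)⟩
      intro t ht
      obtain ⟨i, hi⟩ := h.exists_zpow_mem_Ico hu t
      rw [IsSuccessor.zpow_add_one_apply] at hi
      refine ⟨i, Or.inl ⟨hi.1, ?_⟩⟩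
      by_contra! hcon
      obtain ⟨y, hy, rfl⟩ := IsSuccessor.exists_zpow_eq S i ⟨hcon, hi.2⟩
      exact (hneg y hy).ne (h.mem_of_zpow_mem ht)
  · rintro hs Pminus Pplus hP ⟨xL, xR, -, -, harc, hlt, -⟩
    have hpos := hcase.resolve_right fun hcon => hcon.2.2 hs
    -- The decomposition is arbitrary, so only its periodicity is used: a non-degenerate arc of
    -- periodic points would lift into the fixed points of the return map, which form a countable
    -- set in the strictly concave case.
    have hsub : Icc (xL 0) (xR 0) ⊆ range (fun i : ℤ => (S ^ i : CircleDeg1Liftˣ) u) ∪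
        range (fun i : ℤ => (S ^ i : CircleDeg1Liftˣ) v) := by
      intro t ht
      have hmem : pt t ∈ ⋃ i, Pplus i := by
        refine mem_iUnion.2 ⟨((0 : ℤ) : ZMod q), ?_⟩
        rw [(harc 0).1]
        exact ⟨t, ht, rfl⟩
      have hper := hP.period _ (Or.inl hmem)
      have hper' : pt t ∈ Function.periodicPts (circleHomeo g) :=
        Function.minimalPeriod_pos_iff_mem_periodicPts.1 (by rw [hper]; exact hq)
      obtain ⟨i, hi | hi⟩ := h.fixed_eq_or_eq hu hneg hpos ((h.mem_periodicPts_pt_iff hg).1 hper')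
      · exact Or.inl ⟨i, hi.symm⟩
      · exact Or.inr ⟨i, hi.symm⟩
    have hcount := ((countable_range _).union (countable_range _)).mono hsub
    have h0 : MeasureTheory.volume (Icc (xL 0) (xR 0)) = 0 := hcount.measure_zero _
    rw [Real.volume_Icc, ENNReal.ofReal_eq_zero] at h0
    linarith [(hlt 0).1]

/-! ### The rotation number -/

/-- The difference of two lifts is continuous and integer-valued, hence constant. -/
lemma IsLift.exists_int {g : CircleDeg1Liftˣ} {F : ℝ ≃ₜ ℝ} (hF : IsLift (circleHomeo g) F) :
    ∃ m : ℤ, ∀ x, F x = (turn ^ m * g : CircleDeg1Liftˣ) x := by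
  have h1 : ∀ x, ∃ m : ℤ, F x = g x + m := fun x => by
    have h2 : pt (g x) = pt (F x) := (hF.2 x).symm
    exact pt_eq_pt_iff.1 h2
  choose m hm using h1
  have hcont : Continuous fun x => (m x : ℝ) := by
    have : (fun x => (m x : ℝ)) = fun x => F x - g x := by
      funext x
      rw [hm x]
      ring
    rw [this]
    exact F.continuous.sub (continuous_unit g)
  have hcont' : Continuous m := Int.isClosedEmbedding_coe_real.isEmbedding.continuous_iff.2 hcont
  refine ⟨m 0, fun x => ?_⟩
  rw [unit_mul_apply, turn_zpow_apply, hm x, PreconnectedSpace.constant inferInstance hcont']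

lemma hasRotationNumber {g : CircleDeg1Liftˣ}
    (hg : CircleDeg1Lift.translationNumber g ∈ Ico (0 : ℝ) 1) :
    HasRotationNumber (circleHomeo g) (CircleDeg1Lift.translationNumber g) := by
  refine ⟨hg, ⟨(CircleDeg1Lift.toOrderIso g).toHomeomorph, fun x k => ?_, fun x => ?_⟩,
    fun F hF => ?_⟩
  · exact CircleDeg1Lift.map_add_int (g : CircleDeg1Lift) x k
  · rfl
  · obtain ⟨m, hm⟩ := hF.exists_int
    refine ⟨m, fun x => ?_⟩
    have hτ : CircleDeg1Lift.translationNumber (turn ^ m * g : CircleDeg1Liftˣ) =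
        CircleDeg1Lift.translationNumber g + m := by
      have hc : Commute ((turn ^ m : CircleDeg1Liftˣ) : CircleDeg1Lift) (g : CircleDeg1Lift) :=
        congrArg Units.val ((commute_turn g).symm.zpow_left m).eq
      rw [Units.val_mul, CircleDeg1Lift.translationNumber_mul_of_commute hc,
        CircleDeg1Lift.translationNumber_zpow, turn, CircleDeg1Lift.translationNumber_translate,
        mul_one, add_comm]
    have h1 := CircleDeg1Lift.tendsto_translationNumber (turn ^ m * g : CircleDeg1Liftˣ) x
    rw [hτ] at h1
    have h2 : (F : ℝ → ℝ) = ((turn ^ m * g : CircleDeg1Liftˣ) : CircleDeg1Lift) := funext hm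
    rw [h2]
    simpa only [CircleDeg1Lift.coe_pow] using h1

/-- The lift of the return map with translation number in `[0, 1)`. -/
lemma exists_return_lift {b : ℝ → ℝ} (hb : IsProfile b) {θ : ℝ}
    (hθ : θ ∈ Ioo (alphaMax b) (Real.pi / 2)) :
    ∃ (g : CircleDeg1Liftˣ) (c K : ℝ), 0 < K ∧
      CircleDeg1Lift.translationNumber g ∈ Ico (0 : ℝ) 1 ∧
      (∀ x, FirstReturn b θ x (circleHomeo g x)) ∧
      ConcaveOn ℝ (Icc c (c + 1)) g ∧
      (∀ x y, x ≤ y → y - x ≤ K * (g y - g x)) ∧ (∀ x y, x ≤ y → g y - g x ≤ K * (y - x)) ∧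
      (StrictConcaveOn ℝ (Icc (-1 / 2) (1 / 2)) b → StrictConcaveOn ℝ (Icc c (c + 1)) g) := by
  have hα := hθ.1.trans hθ.2
  have hα0 := alphaMax_nonneg b
  have hθ0 : 0 < θ := hα0.trans_lt hθ.1
  have hsin : 0 < Real.sin θ := Real.sin_pos_of_pos_of_lt_pi hθ0 (by linarith [hθ.2])
  have hcos : 0 < Real.cos θ := Real.cos_pos_of_mem_Ioo ⟨by linarith, hθ.2⟩
  have htan : 0 < Real.tan θ := Real.tan_pos_of_pos_of_lt_pi_div_two hθ0 hθ.2
  have htα : 0 ≤ Real.tan (alphaMax b) :=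
    Real.tan_nonneg_of_nonneg_of_le_pi_div_two hα0 hα.le
  have hlt : Real.tan (alphaMax b) < Real.tan θ :=
    Real.tan_lt_tan_of_lt_of_lt_pi_div_two (by linarith) hθ.2 hθ.1
  have hlip : ∀ x y, x ≤ y →
      |roof b (pt y) - roof b (pt x)| ≤ Real.tan (alphaMax b) * (y - x) :=
    fun x y hxy => abs_roof_sub_le hb hα hxy
  have heq : EqOn b (fun t => roof b (pt t)) (Icc (-1 / 2 : ℝ) (1 / 2)) :=
    fun t ht => (roof_coe_of_mem hb ht).symm
  obtain ⟨g, c, K, hK, hg, hconc, hlow, hup, hstrict⟩ :=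
    exists_concave_lift (β := fun t => roof b (pt t) / Real.tan θ)
      (κ := Real.tan (alphaMax b) / Real.tan θ) (by positivity) ((div_lt_one htan).2 hlt)
      (fun x => by simp only [pt_add_one]) (fun x y hxy => by
        rw [← sub_div, abs_div, abs_of_pos htan, div_mul_eq_mul_div]
        exact div_le_div_of_nonneg_right (hlip x y hxy) htan.le)
      (by
        have h1 := (hb.concaveOn.congr heq).smul (inv_nonneg.2 htan.le)
        refine h1.congr fun t _ => ?_
        simp only [smul_eq_mul]
        ring)
  -- An integer translation leaves the circle map and the concavity unchanged, and brings the
  -- translation number into `[0, 1)`.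
  set m : ℤ := -⌊CircleDeg1Lift.translationNumber g⌋ with hm
  have happly : ∀ x, (turn ^ m * g : CircleDeg1Liftˣ) x = g x + m := fun x => by
    rw [unit_mul_apply, turn_zpow_apply]
  refine ⟨turn ^ m * g, c, K, hK, ?_, ?_, ?_, ?_, ?_, ?_⟩
  · have hc : Commute ((turn ^ m : CircleDeg1Liftˣ) : CircleDeg1Lift) (g : CircleDeg1Lift) :=
      congrArg Units.val ((commute_turn g).symm.zpow_left m).eq
    rw [Units.val_mul, CircleDeg1Lift.translationNumber_mul_of_commute hc,
      CircleDeg1Lift.translationNumber_zpow, turn, CircleDeg1Lift.translationNumber_translate,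
      mul_one, hm, Int.cast_neg, neg_add_eq_sub, Int.self_sub_floor]
    exact ⟨Int.fract_nonneg _, Int.fract_lt_one _⟩
  · intro x
    obtain ⟨t, rfl⟩ := pt_surjective x
    rw [circleHomeo_pt, happly, pt_add_int]
    obtain ⟨w, rfl, hw⟩ := hg t
    rw [hw]
    refine firstReturn_pt hb hsin hcos (fun x y hxy => ?_) (fun x y hxy => ?_) w
    · exact (hlip x y hxy).trans (mul_le_mul_of_nonneg_right hlt.le (sub_nonneg.2 hxy))
    · exact (hlip x y hxy.le).trans_lt (mul_lt_mul_of_pos_right hlt (sub_pos.2 hxy))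
  · exact (hconc.add_const (m : ℝ)).congr fun x _ => (happly x).symm
  · intro x y hxy
    rw [happly, happly, add_sub_add_right_eq_sub]
    exact hlow x y hxy
  · intro x y hxy
    rw [happly, happly, add_sub_add_right_eq_sub]
    exact hup x y hxy
  · intro hs
    refine ((hstrict ?_).add_const (m : ℝ)).congr fun x _ => (happly x).symm
    have h1 := hs.congr heq
    refine ⟨h1.1, fun x hx y hy hxy s t hs ht hst => ?_⟩
    have h2 := h1.2 hx hy hxy hs ht hst
    simp only [smul_eq_mul] at h2 ⊢
    rw [← mul_div_assoc, ← mul_div_assoc, ← add_div]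
    exact div_lt_div_of_pos_right h2 htan

end InternalWave

open InternalWave
theorem mainTheorem1 (b : ℝ → ℝ) (hb : IsProfile b) (θ : ℝ)
    (hθ : θ ∈ Ioo (alphaMax b) (Real.pi / 2)) :
    ∃ f : UnitAddCircle ≃ₜ UnitAddCircle,
      (∀ x x' : UnitAddCircle, FirstReturn b θ x x' ↔ f x = x') ∧
      ∃ ρ : ℝ, HasRotationNumber f ρ ∧
        (Irrational ρ →
          (∃ h : UnitAddCircle ≃ₜ UnitAddCircle, ∀ x, h (f x) = h x + (ρ : UnitAddCircle)) ∧
          ∀ x, Dense (range fun n : ℕ => f^[n] x)) ∧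
        (∀ p q : ℕ, 0 < q → p.Coprime q → ρ = (p : ℝ) / q →
          (∃ Pminus Pplus : ZMod q → Set UnitAddCircle,
            IsPeriodicDecomposition f p q Pminus Pplus ∧
            (CaseA f p q Pminus Pplus ∨ CaseB f p q Pminus Pplus)) ∧
          (StrictConcaveOn ℝ (Icc (-1 / 2) (1 / 2)) b →
            ∀ Pminus Pplus : ZMod q → Set UnitAddCircle,
              IsPeriodicDecomposition f p q Pminus Pplus →
              ¬ CaseB f p q Pminus Pplus)) := by
  obtain ⟨g, c, K, hK, hρ, hret, hconc, hlow, hup, hstrict⟩ := exists_return_lift hb hθ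
  refine ⟨circleHomeo g, fun x x' => ⟨fun h => (hret x).unique h, ?_⟩,
    CircleDeg1Lift.translationNumber g, hasRotationNumber hρ, fun hirr => ?_,
    fun p q hq hpq hpq' => ?_⟩
  · rintro rfl
    exact hret x
  · obtain ⟨h, hh⟩ := exists_conj_rotation hK hconc hlow hup hirr
    exact ⟨⟨h, hh⟩, dense_orbit_of_conj_rotation hirr hh⟩
  · obtain ⟨h1, h2⟩ := rational_dynamics hconc hq hpq hpq'
    exact ⟨h1, fun hs => h2 (hstrict hs)⟩
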